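/- Work in $\mathbb{F}_2[x]$. For a nonzero polynomial $A$ let $\sigma(A)$ be the sum of all divisors of $A$ in $\mathbb{F}_2[x]$, and call $A$ perfect if $\sigma(A)=A$. For a polynomial $P$ write $\overline{P}(x)=P(x+1)$. Put $$M_1=1+x+x^2,\quad M_2=1+x+x^3,\quad M_3=1+x^2+x^3,\quad M_4=1+x+x^2+x^3+x^4,\quad M_5=1+x^3+x^4,$$ $$M_6=1+x^3+x^5,\quad M_7=1+x^3+x^7,\quad M_8=1+x^6+x^7,\quad M_9=\overline{M_6},\quad M_{10}=\overline{M_7},\quad M_{11}=\overline{M_8},$$ $$M_{12}=1+x+x^9,\quad M_{13}=1+x^8+x^9,$$ and, for $1\le j\le 15$, $S_j=1+x^{\alpha_j}(x+1)^{\beta_j}M_1^{\nu_j}$, where $(\alpha_j,\beta_j,\nu_j)$ is, in this order, $$(1,1,1),(2,2,1),(1,3,4),(3,1,1),(1,3,1),(3,1,4),(1,1,3),(3,3,1),(1,1,5),(4,1,1),(1,2,1),(2,1,2),(1,4,1),(2,1,1),(1,2,2).$$ Let $A=x^a(x+1)^bA_1$ with $A_1=\prod_{i=1}^{13}M_i^{c_i}\prod_{j=1}^{15}S_j^{d_j}$,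 where $a,b,c_i,d_j$ are non-negative integers, $a,b\ge 1$ and $A_1\ne 1$. Write $$a=2^nu-1,\quad b=2^mv-1,\quad c_i=2^{n_i}u_i-1,\quad d_j=2^{m_j}v_j-1\qquad(1\le i\le 13,\ 1\le j\le 15)$$ with $n,m,n_i,m_j\ge 0$ integers and $u,v,u_i,v_j$ odd positive integers. If $A$ is perfect, then $$u,v\in\{1,3,5,7,9,13,15\},\quad u_1\in\{1,3,5,7,15\},\quad u_2,u_3,v_1\in\{1,3\},\quad u_4=u_5=1,$$ $$c_i=0\ \text{ for } 6\le i\le 13,\qquad d_j\in\{0,1\},\ v_j=1,\ m_j\in\{0,1\}\ \text{ for } 2\le j\le 15,$$ $$n,m,n_1\le 4,\qquad n_2,n_3,m_1\le 3,\qquad n_4,n_5\le 5.$$ In particular, only finitely many polynomials $A$ of this form are perfect. -/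

import Mathlib

namespace BinaryPerfect

open Polynomial

/-- `σ(A)`: the sum of all divisors of `A` in `𝔽₂[x]`. For `A ≠ 0` there are finitely many
divisors (all of them monic), so the finite-support sum is the genuine sum. -/
noncomputable def sigma (A : (ZMod 2)[X]) : (ZMod 2)[X] :=
  ∑ᶠ D ∈ {D : (ZMod 2)[X] | D ∣ A}, D

/-- A nonzero polynomial over `𝔽₂` is perfect if it equals the sum of its divisors. -/
def IsPerfect (A : (ZMod 2)[X]) : Prop :=
  A ≠ 0 ∧ sigma A = A

/-- `S ↦ S̄`: substitution of `x + 1` for `x`. -/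
noncomputable def bar (S : (ZMod 2)[X]) : (ZMod 2)[X] :=
  S.comp (X + 1)

/-- The Mersenne primes `M₁, …, M₁₃` (indices outside `1, …, 13` are never used). -/
noncomputable def M : ℕ → (ZMod 2)[X]
  | 1 => 1 + X + X ^ 2
  | 2 => 1 + X + X ^ 3
  | 3 => 1 + X ^ 2 + X ^ 3
  | 4 => 1 + X + X ^ 2 + X ^ 3 + X ^ 4
  | 5 => 1 + X ^ 3 + X ^ 4
  | 6 => 1 + X ^ 3 + X ^ 5
  | 7 => 1 + X ^ 3 + X ^ 7
  | 8 => 1 + X ^ 6 + X ^ 7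
  | 9 => bar (1 + X ^ 3 + X ^ 5)
  | 10 => bar (1 + X ^ 3 + X ^ 7)
  | 11 => bar (1 + X ^ 6 + X ^ 7)
  | 12 => X ^ 9 + X + 1
  | 13 => X ^ 9 + X ^ 8 + 1
  | _ => 1

/-- `M₁^{abc} = 1 + x^a (x+1)^b M₁^c`. -/
noncomputable def twoMersenne (a b c : ℕ) : (ZMod 2)[X] :=
  1 + X ^ a * (X + 1) ^ b * M 1 ^ c

/-- The 2-Mersenne primes `S₁, …, S₁₅` (indices outside `1, …, 15` are never used). -/
noncomputable def S : ℕ → (ZMod 2)[X]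
  | 1 => twoMersenne 1 1 1
  | 2 => twoMersenne 2 2 1
  | 3 => twoMersenne 1 3 4
  | 4 => twoMersenne 3 1 1
  | 5 => twoMersenne 1 3 1
  | 6 => twoMersenne 3 1 4
  | 7 => twoMersenne 1 1 3
  | 8 => twoMersenne 3 3 1
  | 9 => twoMersenne 1 1 5
  | 10 => twoMersenne 4 1 1
  | 11 => twoMersenne 1 2 1
  | 12 => twoMersenne 2 1 2
  | 13 => twoMersenne 1 4 1
  | 14 => twoMersenne 2 1 1
  | 15 => twoMersenne 1 2 2
  | _ => 1

/-- The odd part `A₁ = ∏_{i=1}^{13} M_i^{c_i} · ∏_{j=1}^{15} S_j^{d_j}`. -/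
noncomputable def oddPart (c d : ℕ → ℕ) : (ZMod 2)[X] :=
  (∏ i ∈ Finset.Icc 1 13, M i ^ c i) * ∏ j ∈ Finset.Icc 1 15, S j ^ d j

/-- `A = x^a (x+1)^b A₁`. -/
noncomputable def polyA (a b : ℕ) (c d : ℕ → ℕ) : (ZMod 2)[X] :=
  X ^ a * (X + 1) ^ b * oddPart c d

end BinaryPerfect

namespace BinaryPerfect
open Polynomial

/-! ### Divisors and exponents in `𝔽₂[x]` -/

/-! Let `P` run over the thirty primes `x`, `x + 1`, `M i`, `S j`. Since σ is multiplicative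
(`sigma_prod_pow`) and Frobenius is additive, an exponent `2^r u - 1` of `P` contributes `(1 +
P)^(2^r - 1) (1 + P + ⋯ + P^(u-1))^(2^r)` to σ(A) (`geom_sum_two_pow_mul`). If A is perfect, each of
these geometric sums divides A, so it factors over the thirty primes.

For odd `u` this leaves finitely many lengths. The derivative of `P^u - 1` is `P^(u-1) P'`, and `P`
is invertible modulo any factor of `P^u - 1`, so repeated factors of the sum must come from `P'`.
Hence the sum divides the fixed polynomial (product of the family) · `P'`
(`geom_sum_dvd_of_eq_prod`), whose degree is below 200. Division with remainder on bit masks leaves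
the table `lengths` (`mem_lengths`).

The sums for the surviving lengths, and every `1 + P`, have explicit factorizations over the family,
so comparing exponents in σ(A) = A gives thirty equations in powers of two
(`exponents_of_isPerfect`). Many primes are eliminated at once. The rest is solved by a finite
search in the quotient of ℕ that keeps numbers below 32 and reduces modulo 32 from there on
(`Near`): every power `2^n` with `n ≥ 5` has the class of 32, and a solution with representative
below 32 is exact. Only the solutions with trivial odd part, among them `x^(2^n-1) (x+1)^(2^n-1)`,
escape the bounds, and A₁ ≠ 1 excludes them. -/

theorem eq_one_of_isUnit {p : (ZMod 2)[X]} (h : IsUnit p) : p = 1 := by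
  obtain ⟨c, hc, rfl⟩ := Polynomial.isUnit_iff.mp h
  have : c = 1 := by
    have h0 := hc.ne_zero
    revert h0
    clear hc h
    revert c
    decide
  rw [this, C_1]

/-- As 1 is the only unit, prime factorizations are literally unique and need no normalization. -/
theorem eq_of_associated {p q : (ZMod 2)[X]} (h : Associated p q) : p = q := by
  obtain ⟨c, rfl⟩ := h
  rw [eq_one_of_isUnit c.isUnit, mul_one]

section Family

variable {ι : Type*} {s : Finset ι} {P : ι → (ZMod 2)[X]}

theorem emultiplicity_prod_pow (hP : ∀ i ∈ s, Irreducible (P i)) (hinj : Set.InjOn P s)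
    (e : ι → ℕ) {k : ι} (hk : k ∈ s) : emultiplicity (P k) (∏ i ∈ s, P i ^ e i) = e k := by
  rw [Finset.emultiplicity_prod (hP k hk).prime, Finset.sum_eq_single_of_mem k hk]
  · exact emultiplicity_pow_self_of_prime (hP k hk).prime _
  · intro j hj hjk
    refine emultiplicity_eq_zero.mpr fun h => hjk ?_
    have h1 := (hP k hk).prime.dvd_of_dvd_pow h
    exact (hinj hk hj (eq_of_associated ((hP k hk).associated_of_dvd (hP j hj) h1))).symm

theorem prod_pow_injective (hP : ∀ i ∈ s, Irreducible (P i)) (hinj : Set.InjOn P s)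
    {e f : ι → ℕ} (h : ∏ i ∈ s, P i ^ e i = ∏ i ∈ s, P i ^ f i) {k : ι} (hk : k ∈ s) :
    e k = f k := by
  have h1 := emultiplicity_prod_pow hP hinj e hk
  rw [h, emultiplicity_prod_pow hP hinj f hk] at h1
  exact_mod_cast h1.symm

theorem prod_pow_ne_zero (hP : ∀ i ∈ s, Irreducible (P i)) (e : ι → ℕ) :
    ∏ i ∈ s, P i ^ e i ≠ 0 :=
  Finset.prod_ne_zero_iff.mpr fun i hi => pow_ne_zero _ (hP i hi).ne_zero

/-- A polynomial all of whose prime factors lie in a family is a product of powers from it. -/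
theorem exists_eq_prod_pow_of_prime_dvd {D : (ZMod 2)[X]} (hD : D ≠ 0)
    (h : ∀ q, Prime q → q ∣ D → ∃ k ∈ s, q = P k) : ∃ f : ι → ℕ, D = ∏ i ∈ s, P i ^ f i := by
  classical
  induction D using UniqueFactorizationMonoid.induction_on_prime with
  | h₁ => exact absurd rfl hD
  | h₂ x hx => exact ⟨fun _ => 0, by simp [eq_one_of_isUnit hx]⟩
  | h₃ a p ha hp ih =>
    obtain ⟨f, hf⟩ := ih ha fun q hq hqa => h q hq (hqa.mul_left p)
    obtain ⟨k, hk, rfl⟩ := h p hp (dvd_mul_right p a)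
    refine ⟨fun i => f i + if i = k then 1 else 0, ?_⟩
    simp only [pow_add, Finset.prod_mul_distrib, ← hf, pow_ite, pow_one, pow_zero]
    rw [Finset.prod_ite_eq' s k, if_pos hk, mul_comm]

theorem exists_eq_prod_pow_of_dvd (hP : ∀ i ∈ s, Irreducible (P i)) {D : (ZMod 2)[X]}
    {e : ι → ℕ} (h : D ∣ ∏ i ∈ s, P i ^ e i) : ∃ f : ι → ℕ, D = ∏ i ∈ s, P i ^ f i := by
  refine exists_eq_prod_pow_of_prime_dvd (ne_zero_of_dvd_ne_zero (prod_pow_ne_zero hP e) h) ?_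
  intro q hq hqD
  obtain ⟨k, hk, hqk⟩ := (hq.dvd_finsetProd_iff _).mp (hqD.trans h)
  exact ⟨k, hk, eq_of_associated
    (hq.irreducible.associated_of_dvd (hP k hk) (hq.dvd_of_dvd_pow hqk))⟩

theorem le_of_prod_pow_dvd (hP : ∀ i ∈ s, Irreducible (P i)) (hinj : Set.InjOn P s)
    {e f : ι → ℕ} (h : ∏ i ∈ s, P i ^ f i ∣ ∏ i ∈ s, P i ^ e i) {k : ι} (hk : k ∈ s) :
    f k ≤ e k := by
  have h1 := emultiplicity_le_emultiplicity_of_dvd_right (a := P k) h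
  rw [emultiplicity_prod_pow hP hinj _ hk, emultiplicity_prod_pow hP hinj _ hk] at h1
  exact_mod_cast h1

/-- Expanding the product of geometric sums gives one term for each choice of exponents, hence each
divisor exactly once. -/
theorem sigma_prod_pow (hP : ∀ i ∈ s, Irreducible (P i)) (hinj : Set.InjOn P s) (e : ι → ℕ) :
    sigma (∏ i ∈ s, P i ^ e i) = ∏ i ∈ s, ∑ j ∈ Finset.range (e i + 1), P i ^ j := by
  classical
  rw [Finset.prod_sum]
  have hset : {D : (ZMod 2)[X] | D ∣ ∏ i ∈ s, P i ^ e i} =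
      ((s.pi fun i => Finset.range (e i + 1)).image
        fun p => ∏ x ∈ s.attach, P x.1 ^ p x.1 x.2 : Finset (ZMod 2)[X]) := by
    ext D
    simp only [Set.mem_ofPred_eq, Finset.coe_image, Set.mem_image, Finset.mem_coe, Finset.mem_pi,
      Finset.mem_range, Nat.lt_succ_iff]
    constructor
    · intro h
      obtain ⟨f, rfl⟩ := exists_eq_prod_pow_of_dvd hP h
      exact ⟨fun i _ => f i, fun i hi => le_of_prod_pow_dvd hP hinj h hi,
        Finset.prod_attach s fun i => P i ^ f i⟩
    · rintro ⟨p, hp, rfl⟩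
      rw [← Finset.prod_attach s fun i => P i ^ e i]
      exact Finset.prod_dvd_prod_of_dvd _ _ fun x _ => pow_dvd_pow _ (hp x.1 x.2)
  rw [sigma, hset, finsum_mem_coe_finset, Finset.sum_image]
  intro p hp q hq hpq
  -- Exponents defined only on `s` are extended by zero, so that uniqueness of factorization
  -- applies.
  have key : ∀ p : (i : ι) → i ∈ s → ℕ, ∏ x ∈ s.attach, P x.1 ^ p x.1 x.2 =
      ∏ i ∈ s, P i ^ (if h : i ∈ s then p i h else 0) := by
    intro p
    rw [← Finset.prod_attach s]
    exact Finset.prod_congr rfl fun x _ => by rw [dif_pos x.2]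
  simp only [key] at hpq
  funext i hi
  have := prod_pow_injective hP hinj hpq hi
  simpa only [dif_pos hi] using this

/-- A geometric sum of odd length that factors over the family has only those multiple
factors that divide the derivative of `Q`. -/
theorem geom_sum_dvd_of_eq_prod (hP : ∀ i ∈ s, Irreducible (P i)) (hinj : Set.InjOn P s)
    {Q : (ZMod 2)[X]} {u : ℕ} (hu : Odd u) {f : ι → ℕ}
    (h : ∑ j ∈ Finset.range u, Q ^ j = ∏ i ∈ s, P i ^ f i) :
    ∑ j ∈ Finset.range u, Q ^ j ∣ (∏ i ∈ s, P i) * derivative Q := by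
  rw [h]
  refine Finset.prod_dvd_of_coprime ?_ ?_
  · intro i hi j hj hij
    refine IsCoprime.pow ((hP i hi).coprime_iff_not_dvd.mpr fun hd => hij ?_)
    exact hinj hi hj (eq_of_associated ((hP i hi).associated_of_dvd (hP j hj) hd))
  · intro i hi
    rcases Nat.eq_zero_or_pos (f i) with h0 | h0
    · simp [h0]
    have hd : P i ^ f i ∣ Q ^ u - 1 := by
      rw [← geom_sum_mul, h]
      exact (Finset.dvd_prod_of_mem (fun i => P i ^ f i) hi).mul_right _
    -- A prime dividing `Q ^ u - 1` cannot divide `Q`, so `Q ^ (u - 1)` can be cancelled from the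
    -- derivative.
    have hcop : IsCoprime (P i ^ (f i - 1)) (Q ^ (u - 1)) := by
      refine IsCoprime.pow ((hP i hi).coprime_iff_not_dvd.mpr fun hQ => ?_)
      have h1 : P i ∣ Q ^ u - 1 := (dvd_pow_self _ h0.ne').trans hd
      have h2 : P i ∣ Q ^ u := hQ.trans (dvd_pow_self _ hu.pos.ne')
      exact (hP i hi).not_isUnit (isUnit_of_dvd_one ((dvd_sub_right h2).mp h1))
    have hder := pow_sub_one_dvd_derivative_of_pow_dvd hd
    have hu1 : (u : (ZMod 2)[X]) = 1 := by
      obtain ⟨w, rfl⟩ := hu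
      have : (2 : (ZMod 2)[X]) = 0 := CharTwo.two_eq_zero
      push_cast
      rw [this]; ring
    rw [derivative_sub, derivative_one, sub_zero, derivative_pow] at hder
    rw [C_eq_natCast, hu1, one_mul] at hder
    have hder' := hcop.dvd_of_dvd_mul_left hder
    obtain ⟨m, hm⟩ : ∃ m, f i = m + 1 := ⟨f i - 1, by omega⟩
    rw [hm, Nat.add_sub_cancel] at hder'
    rw [hm, pow_succ, mul_comm]
    exact mul_dvd_mul (Finset.dvd_prod_of_mem P hi) hder'

end Family

/-- After multiplication by `Q - 1`, both sides are `Q ^ (2 ^ n * u) - 1 = (Q ^ u - 1) ^ 2 ^ n`. -/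
theorem geom_sum_two_pow_mul {Q : (ZMod 2)[X]} (hQ : Q ≠ 1) (n u : ℕ) :
    ∑ j ∈ Finset.range (2 ^ n * u), Q ^ j =
      (1 + Q) ^ (2 ^ n - 1) * (∑ j ∈ Finset.range u, Q ^ j) ^ 2 ^ n := by
  refine mul_right_cancel₀ (sub_ne_zero.mpr hQ) ?_
  have h1 : 1 + Q = Q - 1 := by rw [CharTwo.sub_eq_add, add_comm]
  rw [geom_sum_mul, h1, mul_right_comm, ← pow_succ, Nat.sub_add_cancel Nat.one_le_two_pow,
    ← mul_pow, mul_comm (Q - 1), geom_sum_mul, sub_pow_char_pow, one_pow, ← pow_mul, mul_comm u]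

/-! ### Polynomials over `𝔽₂` as bit masks -/

/-- The polynomial whose coefficients are the binary digits of `n`. -/
noncomputable def toPoly (n : ℕ) : (ZMod 2)[X] :=
  ∑ i ∈ Finset.range n, if n.testBit i then X ^ i else 0

theorem coeff_toPoly (n i : ℕ) : (toPoly n).coeff i = if n.testBit i then 1 else 0 := by
  have h : ∀ j ∈ Finset.range n, (if n.testBit j then X ^ j else 0 : (ZMod 2)[X]).coeff i =
      if i = j then (if n.testBit i then 1 else 0) else 0 := by
    intro j _
    split_ifs <;> simp_all [coeff_X_pow]
  rw [toPoly, finsetSum_coeff, Finset.sum_congr rfl h, Finset.sum_ite_eq]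
  split_ifs with h1 h2 h2
  · rfl
  · rfl
  · exact absurd (Finset.mem_range.mpr (i.lt_two_pow_self.trans_le
      (Nat.ge_two_pow_of_testBit h2))) h1
  · rfl

theorem toPoly_injective : Function.Injective toPoly := by
  intro a b h
  refine Nat.eq_of_testBit_eq fun i => ?_
  have := congrArg (fun p => coeff p i) h
  simp only [coeff_toPoly] at this
  revert this
  cases a.testBit i <;> cases b.testBit i <;> simp

theorem toPoly_zero : toPoly 0 = 0 := by simp [toPoly]

theorem toPoly_one : toPoly 1 = 1 := by simp [toPoly]

theorem toPoly_two : toPoly 2 = X := by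
  have h : Nat.testBit 2 1 = true := rfl
  simp [toPoly, Finset.sum_range_succ, h]

theorem toPoly_xor (a b : ℕ) : toPoly (a ^^^ b) = toPoly a + toPoly b := by
  ext i
  simp only [coeff_add, coeff_toPoly, Nat.testBit_xor]
  cases a.testBit i <;> cases b.testBit i <;> simp [CharTwo.add_self_eq_zero]

theorem toPoly_shiftLeft (a i : ℕ) : toPoly (a <<< i) = toPoly a * X ^ i := by
  ext j
  rw [coeff_mul_X_pow', coeff_toPoly, Nat.testBit_shiftLeft]
  by_cases h : i ≤ j <;> simp [h, coeff_toPoly]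

theorem toPoly_mul_bit (a b : ℕ) (hb : b < 2) : toPoly (a * b) = toPoly a * toPoly b := by
  interval_cases b <;> simp [toPoly_zero, toPoly_one]

theorem degree_toPoly_lt {n d : ℕ} (h : n < 2 ^ d) : (toPoly n).degree < d := by
  rw [degree_lt_iff_coeff_zero]
  intro m hm
  rw [coeff_toPoly, Nat.testBit_lt_two_pow (h.trans_le (Nat.pow_le_pow_right two_pos hm))]
  rfl

theorem natDegree_toPoly {n d : ℕ} (h1 : 2 ^ d ≤ n) (h2 : n < 2 ^ (d + 1)) :
    (toPoly n).natDegree = d := by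
  refine le_antisymm ?_ (le_natDegree_of_ne_zero ?_)
  · refine natDegree_le_iff_degree_le.mpr (Order.lt_succ_iff.mp ?_)
    exact degree_toPoly_lt h2
  · rw [coeff_toPoly]
    have : n.testBit d = true := by
      rw [Nat.testBit_eq_decide_div_mod_eq]
      have : n / 2 ^ d = 1 := by
        rw [Nat.div_eq_iff (by positivity)]
        rw [pow_succ] at h2
        omega
      simp [this]
    simp [this]

/-- Turns a statement about all polynomials of bounded degree into one about finitely many masks. -/
theorem exists_toPoly_eq {p : (ZMod 2)[X]} {d : ℕ} (h : p.degree < d) :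
    ∃ n < 2 ^ d, toPoly n = p := by
  induction d generalizing p with
  | zero =>
    have h0 : p = 0 := by simpa using h
    exact ⟨0, by simp, by rw [toPoly_zero, h0]⟩
  | succ d ih =>
    have hp := h
    obtain ⟨n, hn, hnp⟩ := ih (p := p - C (p.coeff d) * X ^ d) (by
      rw [degree_lt_iff_coeff_zero] at hp ⊢
      intro m hm
      rw [coeff_sub, coeff_C_mul, coeff_X_pow]
      rcases hm.eq_or_lt with rfl | hm
      · simp
      · rw [hp m hm]; simp [hm.ne'])
    have hc : p.coeff d = 0 ∨ p.coeff d = 1 := by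
      generalize p.coeff d = c
      revert c; decide
    rcases hc with hc | hc
    · refine ⟨n, hn.trans (Nat.pow_lt_pow_right one_lt_two d.lt_succ_self), ?_⟩
      rw [hnp, hc]; simp
    · refine ⟨n ^^^ (1 <<< d), Nat.xor_lt_two_pow (hn.trans
        (Nat.pow_lt_pow_right one_lt_two d.lt_succ_self)) ?_, ?_⟩
      · rw [Nat.one_shiftLeft]; exact Nat.pow_lt_pow_right one_lt_two d.lt_succ_self
      · rw [toPoly_xor, hnp, hc, toPoly_shiftLeft, toPoly_one]; simp

/-- Carry-less product of `a` with the lowest `f` bits of `b`. -/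
def clmul : ℕ → ℕ → ℕ → ℕ
  | 0, _, _ => 0
  | f + 1, a, b => (a * (b % 2)) ^^^ (clmul f a (b / 2) <<< 1)

theorem toPoly_bit (b : ℕ) : toPoly b = toPoly (b % 2) + toPoly (b / 2) * X := by
  conv_rhs => rw [← pow_one X, ← toPoly_shiftLeft, ← toPoly_xor]
  congr 1
  refine Nat.eq_of_testBit_eq fun i => ?_
  rw [Nat.testBit_xor, Nat.testBit_shiftLeft]
  cases i with
  | zero => simp
  | succ i => simp [Nat.testBit_succ, Nat.mod_div_self]

theorem toPoly_clmul {f b : ℕ} (a : ℕ) (hb : b < 2 ^ f) :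
    toPoly (clmul f a b) = toPoly a * toPoly b := by
  induction f generalizing b with
  | zero =>
    obtain rfl : b = 0 := by simpa using hb
    simp [clmul, toPoly_zero]
  | succ f ih =>
    rw [clmul, toPoly_xor, toPoly_shiftLeft, ih (by rw [pow_succ] at hb; omega),
      toPoly_mul_bit _ _ (Nat.mod_lt _ two_pos), toPoly_bit b]
    ring

/-- Remainder of `r` by `q`, a mask of degree `d`; the quotient has degree below the first
argument. -/
def clmod (q d : ℕ) : ℕ → ℕ → ℕ
  | 0, r => r
  | i + 1, r => clmod q d i (r ^^^ ((q <<< i) * ((r >>> (i + d)) % 2)))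

/-- Each step only adds a multiple of `q`, so this holds for any `d` and any number of steps. That
the result is a true remainder is checked separately in `notDvd`. -/
theorem toPoly_dvd_sub_clmod (q d i r : ℕ) : toPoly q ∣ toPoly r - toPoly (clmod q d i r) := by
  induction i generalizing r with
  | zero => simp [clmod]
  | succ i ih =>
    have h := ih (r ^^^ ((q <<< i) * ((r >>> (i + d)) % 2)))
    rw [toPoly_xor, toPoly_mul_bit _ _ (Nat.mod_lt _ two_pos), toPoly_shiftLeft] at h
    rw [clmod]
    have h2 : toPoly q ∣ toPoly q * X ^ i * toPoly ((r >>> (i + d)) % 2) :=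
      ⟨_, by rw [mul_assoc]⟩
    have := dvd_sub h h2
    convert this using 1
    ring

/-- `r` is not divisible by `q`, witnessed by a nonzero remainder. -/
def notDvd (q d f r : ℕ) : Bool :=
  Nat.ble (2 ^ d) q && Nat.blt (clmod q d f r) (2 ^ d) && Nat.blt 0 (clmod q d f r)

theorem not_dvd_of_notDvd {q d f r : ℕ} (h : notDvd q d f r = true) : ¬ toPoly q ∣ toPoly r := by
  simp only [notDvd, Bool.and_eq_true, Nat.ble_eq, Nat.blt_eq] at h
  obtain ⟨⟨h1, h2⟩, h3⟩ := h
  intro hd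
  have hd' : toPoly q ∣ toPoly (clmod q d f r) := by
    have := dvd_sub hd (toPoly_dvd_sub_clmod q d f r)
    rwa [sub_sub_cancel] at this
  have hne : toPoly (clmod q d f r) ≠ 0 := by
    rw [← toPoly_zero]
    exact fun h => h3.ne' (toPoly_injective h)
  have hq : (d : WithBot ℕ) ≤ (toPoly q).degree := by
    by_contra hlt
    obtain ⟨n, hn, hnq⟩ := exists_toPoly_eq (not_le.mp hlt)
    rw [toPoly_injective hnq] at hn
    omega
  exact absurd (degree_le_of_dvd hd' hne) (not_le.mpr ((degree_toPoly_lt h2).trans_le hq))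

/-- Trial division by all masks of degree at most `d / 2`. -/
def irredCheck (p d : ℕ) : Bool :=
  Nat.ble (2 ^ d) p && Nat.blt p (2 ^ (d + 1)) &&
    (List.range (2 ^ (d / 2 + 1) - 2)).all fun q => notDvd (q + 2) (q + 2).log2 (d + 1) p

theorem irreducible_of_irredCheck {p d : ℕ} (hd : 1 ≤ d) (h : irredCheck p d = true) :
    Irreducible (toPoly p) := by
  simp only [irredCheck, Bool.and_eq_true, Nat.ble_eq, Nat.blt_eq, List.all_eq_true,
    List.mem_range] at h
  obtain ⟨⟨h1, h2⟩, h3⟩ := h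
  have hdeg := natDegree_toPoly h1 h2
  have key : ∀ a : (ZMod 2)[X], a ∣ toPoly p → a.natDegree ≤ d / 2 → IsUnit a := by
    intro a ha hdega
    obtain ⟨n, hn, rfl⟩ := exists_toPoly_eq (p := a) (d := d / 2 + 1)
      (lt_of_le_of_lt (degree_le_of_natDegree_le hdega) (by exact_mod_cast Nat.lt_succ_self _))
    -- The trial division starts at mask 2: mask 0 divides only zero, and mask 1 is the unit.
    rcases Nat.lt_or_ge n 2 with hn2 | hn2
    · interval_cases n
      · rw [toPoly_zero, zero_dvd_iff] at ha
        rw [ha, natDegree_zero] at hdeg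
        omega
      · rw [toPoly_one]; exact isUnit_one
    · have := h3 (n - 2) (by omega)
      rw [Nat.sub_add_cancel hn2] at this
      exact absurd ha (not_dvd_of_notDvd this)
  refine ⟨fun hu => ?_, fun a b hab => ?_⟩
  · rw [natDegree_eq_zero_of_isUnit hu] at hdeg
    omega
  · have hne : toPoly p ≠ 0 := by
      intro h0
      rw [h0, natDegree_zero] at hdeg
      omega
    have hsum : a.natDegree + b.natDegree = d := by
      rw [← hdeg, hab, natDegree_mul (left_ne_zero_of_mul (hab ▸ hne))
        (right_ne_zero_of_mul (hab ▸ hne))]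
    rcases Nat.le_total a.natDegree b.natDegree with hle | hle
    · exact .inl (key a ⟨b, hab⟩ (by omega))
    · exact .inr (key b ⟨a, by rw [hab, mul_comm]⟩ (by omega))

/-- Formal derivative of a mask of degree at most `13`. -/
def clderiv (p : ℕ) : ℕ := (p >>> 1) &&& 5461

/-- In characteristic 2 only odd powers survive differentiation and they land in even degrees; 5461
has its ones in bits 0, 2, …, 12. -/
theorem toPoly_clderiv {p : ℕ} (hp : p < 2 ^ 14) :
    toPoly (clderiv p) = derivative (toPoly p) := by
  ext i
  rw [coeff_derivative, coeff_toPoly, coeff_toPoly, clderiv, Nat.testBit_and,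
    Nat.testBit_shiftRight, add_comm 1 i]
  rcases Nat.lt_or_ge i 13 with hi | hi
  · interval_cases i <;> cases p.testBit _ <;> (simp; try decide)
  · rw [Nat.testBit_lt_two_pow (hp.trans_le (Nat.pow_le_pow_right two_pos (by omega)))]
    simp

/-! ### The thirty primes -/

/-- Masks of `x`, `x + 1`, `M₁, …, M₁₃`, `S₁, …, S₁₅`, in this order. -/
def mask (k : ℕ) : ℕ :=
  [2, 3, 7, 11, 13, 31, 25, 41, 137, 193, 61, 241, 171, 515, 769,
    19, 109, 8191, 73, 91, 6553, 379, 361, 4915, 145, 55, 253, 239, 37, 131].getD k 1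

/-- The prime polynomials allowed in a factorization. -/
noncomputable def fam (k : ℕ) : (ZMod 2)[X] := toPoly (mask k)

theorem mask_lt (k : ℕ) : mask k < 2 ^ 13 := by
  rcases Nat.lt_or_ge k 30 with hk | hk
  · revert k; decide +kernel
  · rw [mask, List.getD_eq_default _ _ (by simpa using hk)]; norm_num

theorem irreducible_fam {k : ℕ} (hk : k ∈ Finset.range 30) : Irreducible (fam k) := by
  have h : ∀ k < 30, 1 ≤ (mask k).log2 ∧ irredCheck (mask k) (mask k).log2 = true := by
    decide +kernel
  exact irreducible_of_irredCheck (h k (Finset.mem_range.mp hk)).1 (h k (Finset.mem_range.mp hk)).2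

theorem injOn_fam : Set.InjOn fam (Finset.range 30) := by
  intro i hi j hj h
  have h1 := toPoly_injective h
  have h2 : ∀ i < 30, ∀ j < 30, mask i = mask j → i = j := by decide +kernel
  exact h2 i (by simpa using hi) j (by simpa using hj) h1

/-- Mask of the product of the first `n` members of the family. -/
def maskProd : ℕ → ℕ
  | 0 => 1
  | n + 1 => clmul 13 (maskProd n) (mask n)

theorem toPoly_maskProd (n : ℕ) : toPoly (maskProd n) = ∏ k ∈ Finset.range n, fam k := by
  induction n with
  | zero => simp [maskProd, toPoly_one]
  | succ n ih => rw [maskProd, toPoly_clmul _ (mask_lt n), ih, Finset.prod_range_succ, fam]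

/-! ### Admissible odd lengths of geometric sums -/

/-- Starting from the geometric sum `s` of `p` of odd length `u`, tests that among the next `f`
odd lengths only those in `l` give a divisor of `H`. -/
def geomCheck (p dp H : ℕ) (l : List ℕ) : ℕ → ℕ → ℕ → Bool
  | 0, _, _ => true
  | f + 1, s, u =>
    (l.contains (u + 2) ||
      notDvd (clmul 13 (clmul 13 s p ^^^ 1) p ^^^ 1) ((u + 1) * dp) (200 - (u + 1) * dp) H) &&
    geomCheck p dp H l f (clmul 13 (clmul 13 s p ^^^ 1) p ^^^ 1) (u + 2)

/-- Odd lengths for which the geometric sum of the `k`-th prime factors over the family. -/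
def lengths : ℕ → List ℕ
  | 0 => [1, 3, 5, 7, 9, 13, 15]
  | 1 => [1, 3, 5, 7, 9, 13, 15]
  | 2 => [1, 3, 5, 7, 15]
  | 3 => [1, 3]
  | 4 => [1, 3]
  | 15 => [1, 3]
  | 16 => [1, 3]
  | _ => [1]

/-- Mask of the product of the whole family. -/
def famMask : ℕ := 149429938730656754798656153536097192182284013793512350378

theorem maskProd_eq : maskProd 30 = famMask := by decide +kernel

theorem geomCheck_mask : ∀ k < 30,
    geomCheck (mask k) (mask k).log2 (clmul 14 famMask (clderiv (mask k))) (lengths k)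
      (100 / (mask k).log2) 1 1 = true := by
  decide +kernel

theorem mem_of_geomCheck {p dp H : ℕ} {l : List ℕ} (hp : p < 2 ^ 13) {f s u w : ℕ}
    (h : geomCheck p dp H l f s u = true)
    (hs : toPoly s = ∑ j ∈ Finset.range u, toPoly p ^ j) (hu : Odd u) (hw : Odd w)
    (huw : u < w) (hwf : w ≤ u + 2 * f)
    (hd : ∑ j ∈ Finset.range w, toPoly p ^ j ∣ toPoly H) : w ∈ l := by
  induction f generalizing s u with
  | zero => omega
  | succ f ih =>
    have hs' : toPoly (clmul 13 (clmul 13 s p ^^^ 1) p ^^^ 1) =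
        ∑ j ∈ Finset.range (u + 2), toPoly p ^ j := by
      rw [toPoly_xor, toPoly_clmul _ hp, toPoly_xor, toPoly_clmul _ hp, toPoly_one, hs,
        geom_sum_succ, geom_sum_succ]
      ring
    simp only [geomCheck, Bool.and_eq_true, Bool.or_eq_true, List.contains_iff_mem] at h
    by_cases hw2 : w = u + 2
    · subst hw2
      rw [← hs'] at hd
      exact h.1.resolve_right fun hn => not_dvd_of_notDvd hn hd
    · obtain ⟨a, ha⟩ := hu
      obtain ⟨b, hb⟩ := hw
      exact ih h.2 hs' ⟨a + 1, by omega⟩ (by omega) (by omega)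

/-- The sum divides a fixed nonzero polynomial of degree below 200, so long sums fail by degree and
the others by explicit division. -/
theorem mem_lengths {k u : ℕ} (hk : k ∈ Finset.range 30) (hu : Odd u) {e : ℕ → ℕ}
    (h : ∑ j ∈ Finset.range u, fam k ^ j ∣ ∏ i ∈ Finset.range 30, fam i ^ e i) :
    u ∈ lengths k := by
  obtain ⟨f, hf⟩ := exists_eq_prod_pow_of_dvd (fun i hi => irreducible_fam hi) h
  have hd := geom_sum_dvd_of_eq_prod (fun i hi => irreducible_fam hi) injOn_fam hu hf
  have hk' := Finset.mem_range.mp hk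
  have hlt : mask k < 2 ^ 14 := (mask_lt k).trans (by norm_num)
  have hH : (∏ i ∈ Finset.range 30, fam i) * derivative (fam k) =
      toPoly (clmul 14 (maskProd 30) (clderiv (mask k))) := by
    have hc : clderiv (mask k) < 2 ^ 14 :=
      lt_of_le_of_lt Nat.and_le_right (by norm_num)
    rw [toPoly_clmul _ hc, toPoly_maskProd, toPoly_clderiv hlt, fam]
  rw [hH, maskProd_eq] at hd
  obtain ⟨hdeg1, hdeg2, hHlt, hH0, hone⟩ : 2 ^ (mask k).log2 ≤ mask k ∧
      1 ≤ (mask k).log2 ∧ clmul 14 famMask (clderiv (mask k)) < 2 ^ 200 ∧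
      clmul 14 famMask (clderiv (mask k)) ≠ 0 ∧ 1 ∈ lengths k := by
    have : ∀ k < 30, 2 ^ (mask k).log2 ≤ mask k ∧
      1 ≤ (mask k).log2 ∧ clmul 14 famMask (clderiv (mask k)) < 2 ^ 200 ∧
      clmul 14 famMask (clderiv (mask k)) ≠ 0 ∧ 1 ∈ lengths k := by decide +kernel
    exact this k hk'
  have hnd : (fam k).natDegree = (mask k).log2 :=
    natDegree_toPoly hdeg1 Nat.lt_log2_self
  rcases Nat.lt_or_ge 1 u with hu1 | hu1
  · rcases le_or_gt u (1 + 2 * (100 / (mask k).log2)) with hle | hgt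
    · exact mem_of_geomCheck (mask_lt k) (geomCheck_mask k hk') (by simp [toPoly_one])
        odd_one hu hu1 hle hd
    -- Here `u ≥ 2 * (100 / deg + 1) + 1`, so the sum has degree above 200. Multiplying by `fam k -
    -- 1` turns it into `fam k ^ u - 1`, whose degree is read off directly.
    · exfalso
      set H := toPoly (clmul 14 famMask (clderiv (mask k)))
      have hHne : H ≠ 0 := by
        rw [← toPoly_zero]
        exact fun h => hH0 (toPoly_injective h)
      have hHdeg : H.natDegree < 200 :=
        (natDegree_lt_iff_degree_lt hHne).mpr (degree_toPoly_lt hHlt)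
      have hpos : 0 < (fam k).natDegree := by omega
      have hQ : fam k - 1 ≠ 0 := by
        intro h0
        rw [sub_eq_zero.mp h0, natDegree_one] at hpos
        omega
      have h1 := natDegree_le_of_dvd (mul_dvd_mul_right hd (fam k - 1)) (mul_ne_zero hHne hQ)
      have hsub : ∀ q : (ZMod 2)[X], 0 < q.natDegree → (q - 1).natDegree = q.natDegree :=
        fun q hq => by rw [← C_1, natDegree_sub_C]
      rw [geom_sum_mul, natDegree_mul hHne hQ, hsub _ hpos,
        hsub _ (by rw [natDegree_pow]; positivity), natDegree_pow, hnd] at h1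
      have h2 : 100 < (mask k).log2 * (100 / (mask k).log2 + 1) :=
        Nat.lt_mul_div_succ 100 (by omega)
      have h3 : (2 * (100 / (mask k).log2) + 2 + 1) * (mask k).log2 ≤ u * (mask k).log2 :=
        Nat.mul_le_mul_right _ (by
          obtain ⟨a, ha⟩ := hu
          omega)
      have h4 : (2 * (100 / (mask k).log2) + 2 + 1) * (mask k).log2 =
          2 * ((mask k).log2 * (100 / (mask k).log2 + 1)) + (mask k).log2 := by ring
      omega
  · obtain rfl : u = 1 := by
      have := hu.pos
      omega
    exact hone

/-! ### Explicit factorizations and the exponent equations -/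

/-- Mask of the product of the members of the family with indices in `l`. -/
def maskList : List ℕ → ℕ
  | [] => 1
  | k :: l => clmul 13 (maskList l) (mask k)

theorem toPoly_maskList (l : List ℕ) : toPoly (maskList l) = (l.map fam).prod := by
  induction l with
  | nil => simp [maskList, toPoly_one]
  | cons k l ih => rw [maskList, toPoly_clmul _ (mask_lt k), ih, List.map_cons, List.prod_cons,
      mul_comm, fam]

theorem prod_map_fam {l : List ℕ} (hl : ∀ k ∈ l, k < 30) :
    (l.map fam).prod = ∏ j ∈ Finset.range 30, fam j ^ l.count j := by
  rw [Finset.prod_list_map_count]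
  refine Finset.prod_subset (fun k hk => ?_) fun k _ hk => ?_
  · exact Finset.mem_range.mpr (hl k (List.mem_toFinset.mp hk))
  · rw [List.count_eq_zero_of_not_mem (by simpa using hk), pow_zero]

/-- Mask of the geometric sum of length `n`. -/
def geomMask (p : ℕ) : ℕ → ℕ
  | 0 => 0
  | n + 1 => clmul 13 (geomMask p n) p ^^^ 1

theorem toPoly_geomMask {p : ℕ} (hp : p < 2 ^ 13) (n : ℕ) :
    toPoly (geomMask p n) = ∑ j ∈ Finset.range n, toPoly p ^ j := by
  induction n with
  | zero => simp [geomMask, toPoly_zero]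
  | succ n ih => rw [geomMask, toPoly_xor, toPoly_clmul _ hp, ih, toPoly_one,
      geom_sum_succ, mul_comm]

/-- Indices of the prime factors of the geometric sum of length `u` of the `k`-th prime. -/
def parts : ℕ → ℕ → List ℕ
  | 0, 3 => [2]
  | 0, 5 => [5]
  | 0, 7 => [3, 4]
  | 0, 9 => [2, 18]
  | 0, 13 => [17]
  | 0, 15 => [2, 5, 6, 15]
  | 1, 3 => [2]
  | 1, 5 => [6]
  | 1, 7 => [3, 4]
  | 1, 9 => [2, 19]
  | 1, 13 => [20]
  | 1, 15 => [2, 5, 6, 15]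
  | 2, 3 => [15]
  | 2, 5 => [22]
  | 2, 7 => [3, 4, 16]
  | 2, 15 => [5, 6, 15, 21, 22]
  | 3, 3 => [2, 6]
  | 4, 3 => [2, 5]
  | 15, 3 => [5, 6]
  | 16, 3 => [15, 21]
  | _, _ => []

/-- Exponents of `x`, `x + 1` and `M₁` in `1 + P`, for `P` the `k`-th prime. -/
def succExps (k : ℕ) : ℕ × ℕ × ℕ :=
  [(0, 1, 0), (1, 0, 0), (1, 1, 0), (1, 2, 0), (2, 1, 0), (1, 3, 0), (3, 1, 0),
    (3, 2, 0), (3, 4, 0), (6, 1, 0), (2, 3, 0),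
    (4, 3, 0), (1, 6, 0), (1, 8, 0), (8, 1, 0), (1, 1, 1), (2, 2, 1),
    (1, 3, 4), (3, 1, 1), (1, 3, 1), (3, 1, 4), (1, 1, 3), (3, 3, 1), (1, 1, 5), (4, 1, 1),
    (1, 2, 1), (2, 1, 2), (1, 4, 1), (2, 1, 1), (1, 2, 2)].getD k (0, 0, 0)

/-- Indices of the prime factors of `1 + P`, for `P` the `k`-th prime. -/
def succParts (k : ℕ) : List ℕ :=
  List.replicate (succExps k).1 0 ++ List.replicate (succExps k).2.1 1 ++
    List.replicate (succExps k).2.2 2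

theorem geom_sum_fam {k u : ℕ} (hk : k ∈ Finset.range 30) (hu : u ∈ lengths k) :
    ∑ j ∈ Finset.range u, fam k ^ j = ∏ j ∈ Finset.range 30, fam j ^ (parts k u).count j := by
  have h : ∀ k < 30, ∀ u ∈ lengths k, (∀ j ∈ parts k u, j < 30) ∧
      geomMask (mask k) u = maskList (parts k u) := by decide +kernel
  obtain ⟨h1, h2⟩ := h k (Finset.mem_range.mp hk) u hu
  rw [← prod_map_fam h1, ← toPoly_maskList, ← h2, toPoly_geomMask (mask_lt k), fam]

theorem one_add_fam {k : ℕ} (hk : k ∈ Finset.range 30) :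
    1 + fam k = ∏ j ∈ Finset.range 30, fam j ^ (succParts k).count j := by
  have h : ∀ k < 30, (∀ j ∈ succParts k, j < 30) ∧
      1 ^^^ mask k = maskList (succParts k) := by decide +kernel
  obtain ⟨h1, h2⟩ := h k (Finset.mem_range.mp hk)
  rw [← prod_map_fam h1, ← toPoly_maskList, ← h2, toPoly_xor, toPoly_one, fam]

/-- The exponent equations satisfied by a perfect polynomial over the family. -/
theorem exponents_of_isPerfect {e r u : ℕ → ℕ}
    (he : ∀ k ∈ Finset.range 30, Odd (u k) ∧ e k + 1 = 2 ^ r k * u k)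
    (h : IsPerfect (∏ k ∈ Finset.range 30, fam k ^ e k)) :
    (∀ k ∈ Finset.range 30, u k ∈ lengths k) ∧
    ∀ j ∈ Finset.range 30, e j = ∑ k ∈ Finset.range 30,
      ((2 ^ r k - 1) * (succParts k).count j + 2 ^ r k * (parts k (u k)).count j) := by
  have hs := h.2
  rw [sigma_prod_pow (fun i hi => irreducible_fam hi) injOn_fam] at hs
  have hgeom : ∀ k ∈ Finset.range 30, ∑ j ∈ Finset.range (e k + 1), fam k ^ j =
      (1 + fam k) ^ (2 ^ r k - 1) * (∑ j ∈ Finset.range (u k), fam k ^ j) ^ 2 ^ r k := by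
    intro k hk
    rw [(he k hk).2]
    exact geom_sum_two_pow_mul (irreducible_fam hk).ne_one _ _
  have hlen : ∀ k ∈ Finset.range 30, u k ∈ lengths k := by
    intro k hk
    refine mem_lengths hk (he k hk).1 (e := e) ?_
    rw [← hs]
    refine dvd_trans ?_ (Finset.dvd_prod_of_mem _ hk)
    rw [hgeom k hk]
    exact (dvd_pow_self _ (by positivity)).mul_left _
  refine ⟨hlen, fun j hj => ?_⟩
  refine prod_pow_injective (f := fun j => ∑ k ∈ Finset.range 30,
    ((2 ^ r k - 1) * (succParts k).count j + 2 ^ r k * (parts k (u k)).count j))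
    (fun i hi => irreducible_fam hi) injOn_fam ?_ hj
  rw [← hs]
  simp only [← Finset.prod_pow_eq_pow_sum]
  rw [Finset.prod_comm]
  refine Finset.prod_congr rfl fun k hk => ?_
  rw [hgeom k hk, one_add_fam hk, geom_sum_fam hk (hlen k hk), ← Finset.prod_pow,
    ← Finset.prod_pow, ← Finset.prod_mul_distrib]
  refine Finset.prod_congr rfl fun j _ => ?_
  rw [← pow_mul, ← pow_mul, ← pow_add, mul_comm, mul_comm (2 ^ r k)]

/-! ### Solving the exponent equations -/

/-- Equality of natural numbers below `32`, congruence modulo `32` from there on. It is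
compatible with addition and multiplication, and has finitely many classes. -/
def Near (a b : ℕ) : Prop := a = b ∨ (32 ≤ a ∧ 32 ≤ b ∧ a % 32 = b % 32)

/-- Boolean form of `Near`. -/
def nearB (a b : ℕ) : Bool :=
  Nat.beq a b || (Nat.ble 32 a && Nat.ble 32 b && Nat.beq (a % 32) (b % 32))

theorem nearB_iff {a b : ℕ} : nearB a b = true ↔ Near a b := by
  simp [nearB, Near, and_assoc]

theorem Near.refl (a : ℕ) : Near a a := .inl rfl

theorem Near.symm {a b : ℕ} (h : Near a b) : Near b a := by
  unfold Near at *; omega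

theorem Near.trans {a b c : ℕ} (h : Near a b) (h' : Near b c) : Near a c := by
  unfold Near at *; omega

theorem Near.add {a b c d : ℕ} (h : Near a b) (h' : Near c d) : Near (a + c) (b + d) := by
  unfold Near at *; omega

theorem Near.mul_right {a b : ℕ} (h : Near a b) (c : ℕ) : Near (a * c) (b * c) := by
  induction c with
  | zero => exact .refl _
  | succ c ih => rw [Nat.mul_succ, Nat.mul_succ]; exact ih.add h

/-- Representatives of the powers of two up to `Near`. -/
def pows : List ℕ := [1, 2, 4, 8, 16, 32]

/-- From `2 ^ 5` on, every power of two is a multiple of 32 and so lies in the class of 32. -/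
theorem exists_near_two_pow (n : ℕ) : ∃ N ∈ pows, Near (2 ^ n) N := by
  rcases Nat.lt_or_ge n 5 with h | h
  · exact ⟨2 ^ n, by interval_cases n <;> decide, .refl _⟩
  · obtain ⟨k, rfl⟩ := Nat.exists_eq_add_of_le h
    refine ⟨32, by decide, .inr ?_⟩
    have : 1 ≤ 2 ^ k := Nat.one_le_two_pow
    rw [pow_add]
    omega

/-- The way back from the search: a representative below 32 is the number itself. -/
theorem Near.eq_of_lt {a b : ℕ} (h : Near a b) (hb : b < 32) : a = b := by
  unfold Near at h; omega

/-- Indicator of equality. -/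
def ind (u w : ℕ) : ℕ := (Nat.beq u w).toNat

/-- What remains of the solutions of the exponent equations. -/
def SmallSolution (u v w u₂ v₁ v₂ N M L A D E F G : ℕ) : Prop :=
  v₂ = 1 ∧ L ≤ 16 ∧ A ≤ 8 ∧ D ≤ 8 ∧ F ≤ 16 ∧ G ≤ 16 ∧ E ≤ 2 ∧
      (N ≤ 16 ∧ M ≤ 16 ∨ u = 1 ∧ v = 1 ∧ w = 1 ∧ u₂ = 1 ∧ v₁ = 1 ∧
        L = 1 ∧ A = 1 ∧ D = 1 ∧ F = 1 ∧ G = 1 ∧ E = 1)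

instance (u v w u₂ v₁ v₂ N M L A D E F G : ℕ) :
    Decidable (SmallSolution u v w u₂ v₁ v₂ N M L A D E F G) := by
  unfold SmallSolution; infer_instance

/-- The pairs `(D, w)`, with `D` in `pows` and `w` in `{1, 3}`, for which `D * w` is near `t`. -/
def splits (t : ℕ) : List (ℕ × ℕ) :=
  bif Nat.beq (t % 2) 1 then
    bif Nat.beq t 1 then [(1, 1)] else bif Nat.beq t 3 then [(1, 3)] else []
  else [(2, 1), (4, 1), (8, 1), (16, 1), (32, 1), (2, 3), (4, 3), (8, 3), (16, 3), (32, 3)].filter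
    fun p => nearB (p.1 * p.2) t

theorem mem_splits {D w t : ℕ} (hD : D ∈ pows) (hw : w ∈ [1, 3]) (h : Near (D * w) t) :
    (D, w) ∈ splits t := by
  rcases Nat.mod_two_eq_zero_or_one t with ht | ht
  · have hb : Nat.beq (t % 2) 1 = false := by rw [ht]; rfl
    rw [splits, hb, cond_false, List.mem_filter, nearB_iff]
    refine ⟨?_, h⟩
    fin_cases hD <;> fin_cases hw <;> simp_all [Near] <;> omega
  · have hb : Nat.beq (t % 2) 1 = true := by rw [ht]; rfl
    rw [splits, hb, cond_true]
    fin_cases hD <;> fin_cases hw <;> simp only [Near] at h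
    all_goals first | omega | skip
    · obtain rfl : t = 1 := by omega
      simp
    · obtain rfl : t = 3 := by omega
      decide

/-- Search for the solutions of the exponent equations up to `Near`. -/
def searchSolutions : Bool :=
  (lengths 2).all fun w => pows.all fun L =>
  !(!Nat.beq (ind w 5 + ind w 15) 1 || Nat.beq L 1) ||
  (splits (1 + L * ind w 7)).all fun Ev =>
  (lengths 0).all fun u => pows.all fun N =>
  !(!Nat.beq (ind u 9 + ind u 13) 1 || Nat.beq N 1) ||
  ((lengths 1).all fun v => pows.all fun M =>
  !(!Nat.beq (ind v 9 + ind v 13) 1 || Nat.beq M 1) ||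
  (splits (1 + N * ind u 7 + M * ind v 7 + L * ind w 7)).all fun Au =>
  (splits (1 + N * ind u 15 + M * ind v 15 + L * (ind w 3 + ind w 15) +
    Ev.1 * ind Ev.2 3)).all fun Dv =>
  !nearB (L * w + 1) (N * (ind u 3 + ind u 9 + ind u 15) + M * (ind v 3 + ind v 9 + ind v 15) +
    Au.1 * (2 * ind Au.2 3) + Dv.1 + Ev.1 + L * (3 * ind w 15) + Ev.1 * (3 * ind Ev.2 3) +
    (4 * ind u 13 + ind u 9 + ind v 9 + 4 * ind v 13 + ind w 5 + ind w 15)) ||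
  ((splits (1 + N * (ind u 5 + ind u 15) + M * ind v 15 + L * ind w 15 + Au.1 * ind Au.2 3 +
    Dv.1 * ind Dv.2 3)).all fun Fo => !Nat.beq Fo.2 1 ||
  (splits (1 + N * ind u 15 + M * (ind v 5 + ind v 15) + L * ind w 15 + Au.1 * ind Au.2 3 +
    Dv.1 * ind Dv.2 3)).all fun Go => !Nat.beq Go.2 1 ||
  (!nearB (N * u + 11) (M + L + Au.1 * 3 + Fo.1 + Go.1 * 3 + Dv.1 + Ev.1 * 2 + L * ind w 15 +
    Ev.1 * ind Ev.2 3 +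
    (ind u 13 + 3 * ind u 9 + ind v 9 + 3 * ind v 13 + 3 * ind w 5 + 3 * ind w 15)) ||
  (!nearB (M * v + 11) (N + L + Au.1 * 3 + Fo.1 * 3 + Go.1 + Dv.1 + Ev.1 * 2 + L * ind w 15 +
    Ev.1 * ind Ev.2 3 +
    (3 * ind u 13 + ind u 9 + 3 * ind v 9 + ind v 13 + 3 * ind w 5 + 3 * ind w 15)) ||
  decide (SmallSolution u v w Au.2 Dv.2 Ev.2 N M L Au.1 Dv.1 Ev.1 Fo.1 Go.1)))))

theorem searchSolutions_eq : searchSolutions = true := by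
  decide +kernel

/-- Only `w`, `L`, `u`, `N`, `v`, `M` are enumerated freely. The other pairs (power of two, odd
part) come from `splits` of a right-hand side already known at that point, which keeps the search
small. -/
theorem near_solutions :
    ∀ w ∈ lengths 2, ∀ L ∈ pows, (ind w 5 + ind w 15 = 1 → L = 1) →
    ∀ Ev ∈ splits (1 + L * ind w 7),
    ∀ u ∈ lengths 0, ∀ N ∈ pows, (ind u 9 + ind u 13 = 1 → N = 1) →
    ∀ v ∈ lengths 1, ∀ M ∈ pows, (ind v 9 + ind v 13 = 1 → M = 1) →
    ∀ Au ∈ splits (1 + N * ind u 7 + M * ind v 7 + L * ind w 7),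
    ∀ Dv ∈ splits (1 + N * ind u 15 + M * ind v 15 + L * (ind w 3 + ind w 15) + Ev.1 * ind Ev.2 3),
    Near (L * w + 1) (N * (ind u 3 + ind u 9 + ind u 15) + M * (ind v 3 + ind v 9 + ind v 15) +
      Au.1 * (2 * ind Au.2 3) + Dv.1 + Ev.1 + L * (3 * ind w 15) + Ev.1 * (3 * ind Ev.2 3) +
      (4 * ind u 13 + ind u 9 + ind v 9 + 4 * ind v 13 + ind w 5 + ind w 15)) →
    ∀ Fo ∈ splits (1 + N * (ind u 5 + ind u 15) + M * ind v 15 + L * ind w 15 + Au.1 * ind Au.2 3 +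
      Dv.1 * ind Dv.2 3), Fo.2 = 1 →
    ∀ Go ∈ splits (1 + N * ind u 15 + M * (ind v 5 + ind v 15) + L * ind w 15 + Au.1 * ind Au.2 3 +
      Dv.1 * ind Dv.2 3), Go.2 = 1 →
    Near (N * u + 11) (M + L + Au.1 * 3 + Fo.1 + Go.1 * 3 + Dv.1 + Ev.1 * 2 + L * ind w 15 +
      Ev.1 * ind Ev.2 3 +
      (ind u 13 + 3 * ind u 9 + ind v 9 + 3 * ind v 13 + 3 * ind w 5 + 3 * ind w 15)) →
    Near (M * v + 11) (N + L + Au.1 * 3 + Fo.1 * 3 + Go.1 + Dv.1 + Ev.1 * 2 + L * ind w 15 +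
      Ev.1 * ind Ev.2 3 +
      (3 * ind u 13 + ind u 9 + 3 * ind v 9 + ind v 13 + 3 * ind w 5 + 3 * ind w 15)) →
    SmallSolution u v w Au.2 Dv.2 Ev.2 N M L Au.1 Dv.1 Ev.1 Fo.1 Go.1 := by
  have h := searchSolutions_eq
  simp only [searchSolutions, List.all_eq_true, Bool.or_eq_true, Bool.not_eq_true',
    ← Bool.not_eq_true, nearB_iff, Nat.beq_eq, decide_eq_true_iff, ← imp_iff_not_or] at h
  exact h

theorem two_pow_mul_odd_inj {a b u v : ℕ} (hu : Odd u) (hv : Odd v) (h : 2 ^ a * u = 2 ^ b * v) :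
    2 ^ a = 2 ^ b ∧ u = v := by
  have key : ∀ {a b u v : ℕ}, Odd u → 2 ^ a * u = 2 ^ b * v → a < b → False := by
    intro a b u v hu h hab
    obtain ⟨c, rfl⟩ := Nat.exists_eq_add_of_lt hab
    rw [pow_succ, pow_add, mul_assoc, mul_assoc] at h
    have h1 := Nat.eq_of_mul_eq_mul_left (by positivity) h
    obtain ⟨w, rfl⟩ := hu
    have h2 : 2 ^ c * (2 * v) = 2 * (2 ^ c * v) := by ring
    omega
  obtain rfl : a = b := by
    rcases lt_trichotomy a b with hab | hab | hab
    · exact (key hu h hab).elim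
    · exact hab
    · exact (key hv h.symm hab).elim
  exact ⟨rfl, Nat.eq_of_mul_eq_mul_left (by positivity) h⟩

/-- For `n ≥ 1` the number `1 + 2 ^ n` is odd and exceeds 1, so it is no power of two. This settles
the primes that receive a single geometric factor. -/
theorem two_pow_eq_one_add_two_pow_mul {a n i : ℕ} (hi : i ≤ 1) (h : 2 ^ a = 1 + 2 ^ n * i) :
    2 ^ a = 1 + i ∧ (i = 1 → 2 ^ n = 1) := by
  rcases Nat.le_one_iff_eq_zero_or_eq_one.mp hi with rfl | rfl
  · simpa using h
  · suffices 2 ^ n = 1 by simp_all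
    rcases n with _ | n
    · rfl
    · rcases a with _ | a
      · simp at h
      · rw [pow_succ, pow_succ] at h
        omega

theorem ind_le_one (u w : ℕ) : ind u w ≤ 1 := Bool.toNat_le _

theorem eq_one_of_two_pow_mul_eq_one {a u : ℕ} (h : 2 ^ a * u = 1) : 2 ^ a = 1 ∧ u = 1 := by
  simpa using h

theorem Near.eq_one {x y : ℕ} (h : Near x y) (hx : x = 1) : y = 1 :=
  (h.symm.eq_of_lt (by omega)).trans hx

theorem Near.eq_one_of_add {x y i j : ℕ} (h : Near x y) (hi : i ≤ 1) (h1 : i = 1 → x = 1)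
    (h2 : j = 1 → x = 1) (hij : i + j = 1) : y = 1 := by
  rcases Nat.le_one_iff_eq_zero_or_eq_one.mp hi with h0 | h0
  · exact h.eq_one (h2 (by omega))
  · exact h.eq_one (h1 h0)

/-- A solution of the exponent equations, up to `Near`, is one of those found by the search. -/
theorem exists_smallSolution {n m l a d e f g u v w u₂ v₁ v₂ : ℕ} (hu : u ∈ lengths 0)
    (hv : v ∈ lengths 1) (hw : w ∈ lengths 2) (hu₂ : u₂ ∈ lengths 3) (hv₁ : v₁ ∈ lengths 15)
    (hv₂ : v₂ ∈ lengths 16)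
    (hn9 : ind u 9 = 1 → 2 ^ n = 1) (hn13 : ind u 13 = 1 → 2 ^ n = 1)
    (hm9 : ind v 9 = 1 → 2 ^ m = 1) (hm13 : ind v 13 = 1 → 2 ^ m = 1)
    (hl : ind w 5 + ind w 15 = 1 → 2 ^ l = 1)
    (ee : 2 ^ e * v₂ = 1 + 2 ^ l * ind w 7)
    (ea : 2 ^ a * u₂ = 1 + 2 ^ n * ind u 7 + 2 ^ m * ind v 7 + 2 ^ l * ind w 7)
    (ed : 2 ^ d * v₁ = 1 + 2 ^ n * ind u 15 + 2 ^ m * ind v 15 + 2 ^ l * (ind w 3 + ind w 15) +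
      2 ^ e * ind v₂ 3)
    (ef : 2 ^ f * 1 = 1 + 2 ^ n * (ind u 5 + ind u 15) + 2 ^ m * ind v 15 + 2 ^ l * ind w 15 +
      2 ^ a * ind u₂ 3 + 2 ^ d * ind v₁ 3)
    (eg : 2 ^ g * 1 = 1 + 2 ^ n * ind u 15 + 2 ^ m * (ind v 5 + ind v 15) + 2 ^ l * ind w 15 +
      2 ^ a * ind u₂ 3 + 2 ^ d * ind v₁ 3)
    (el : 2 ^ l * w + 1 = 2 ^ n * (ind u 3 + ind u 9 + ind u 15) +
      2 ^ m * (ind v 3 + ind v 9 + ind v 15) + 2 ^ a * (2 * ind u₂ 3) + 2 ^ d + 2 ^ e +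
      2 ^ l * (3 * ind w 15) + 2 ^ e * (3 * ind v₂ 3) +
      (4 * ind u 13 + ind u 9 + ind v 9 + 4 * ind v 13 + ind w 5 + ind w 15))
    (en : 2 ^ n * u + 11 = 2 ^ m + 2 ^ l + 2 ^ a * 3 + 2 ^ f + 2 ^ g * 3 + 2 ^ d + 2 ^ e * 2 +
      2 ^ l * ind w 15 + 2 ^ e * ind v₂ 3 +
      (ind u 13 + 3 * ind u 9 + ind v 9 + 3 * ind v 13 + 3 * ind w 5 + 3 * ind w 15))
    (em : 2 ^ m * v + 11 = 2 ^ n + 2 ^ l + 2 ^ a * 3 + 2 ^ f * 3 + 2 ^ g + 2 ^ d + 2 ^ e * 2 +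
      2 ^ l * ind w 15 + 2 ^ e * ind v₂ 3 +
      (3 * ind u 13 + ind u 9 + 3 * ind v 9 + ind v 13 + 3 * ind w 5 + 3 * ind w 15)) :
    ∃ N M L A D E F G, Near (2 ^ n) N ∧ Near (2 ^ m) M ∧ Near (2 ^ l) L ∧ Near (2 ^ a) A ∧
      Near (2 ^ d) D ∧ Near (2 ^ e) E ∧ Near (2 ^ f) F ∧ Near (2 ^ g) G ∧
      SmallSolution u v w u₂ v₁ v₂ N M L A D E F G := by
  obtain ⟨N, mN, hN⟩ := exists_near_two_pow n
  obtain ⟨M, mM, hM⟩ := exists_near_two_pow m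
  obtain ⟨L, mL, hL⟩ := exists_near_two_pow l
  obtain ⟨A, mA, hA⟩ := exists_near_two_pow a
  obtain ⟨D, mD, hD⟩ := exists_near_two_pow d
  obtain ⟨E, mE, hE⟩ := exists_near_two_pow e
  obtain ⟨F, mF, hF⟩ := exists_near_two_pow f
  obtain ⟨G, mG, hG⟩ := exists_near_two_pow g
  refine ⟨N, M, L, A, D, E, F, G, hN, hM, hL, hA, hD, hE, hF, hG, ?_⟩
  refine near_solutions w hw L mL (fun h => hL.eq_one (hl h))
    (E, v₂) (mem_splits mE hv₂ <| (hE.mul_right _).symm.trans <| ee ▸ ?_)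
    u hu N mN (hN.eq_one_of_add (ind_le_one _ _) hn9 hn13)
    v hv M mM (hM.eq_one_of_add (ind_le_one _ _) hm9 hm13)
    (A, u₂) (mem_splits mA hu₂ <| (hA.mul_right _).symm.trans <| ea ▸ ?_)
    (D, v₁) (mem_splits mD hv₁ <| (hD.mul_right _).symm.trans <| ed ▸ ?_)
    (((hL.mul_right _).add (.refl 1)).symm.trans <| el ▸ ?_)
    (F, 1) (mem_splits mF (by decide) <| (hF.mul_right _).symm.trans <| ef ▸ ?_) rfl
    (G, 1) (mem_splits mG (by decide) <| (hG.mul_right _).symm.trans <| eg ▸ ?_) rfl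
    (((hN.mul_right _).add (.refl 11)).symm.trans <| en ▸ ?_)
    (((hM.mul_right _).add (.refl 11)).symm.trans <| em ▸ ?_)
  · exact (Near.refl 1).add (hL.mul_right _)
  · exact (((Near.refl 1).add (hN.mul_right _)).add (hM.mul_right _)).add (hL.mul_right _)
  · exact ((((Near.refl 1).add (hN.mul_right _)).add (hM.mul_right _)).add
      (hL.mul_right _)).add (hE.mul_right _)
  · exact (((((((hN.mul_right _).add (hM.mul_right _)).add (hA.mul_right _)).add hD).add
      hE).add (hL.mul_right _)).add (hE.mul_right _)).add (.refl _)
  · exact (((((Near.refl 1).add (hN.mul_right _)).add (hM.mul_right _)).add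
      (hL.mul_right _)).add (hA.mul_right _)).add (hD.mul_right _)
  · exact (((((Near.refl 1).add (hN.mul_right _)).add (hM.mul_right _)).add
      (hL.mul_right _)).add (hA.mul_right _)).add (hD.mul_right _)
  · exact ((((((((hM.add hL).add (hA.mul_right _)).add hF).add (hG.mul_right _)).add hD).add
      (hE.mul_right _)).add (hL.mul_right _)).add (hE.mul_right _)).add (.refl _)
  · exact ((((((((hN.add hL).add (hA.mul_right _)).add (hF.mul_right _)).add hG).add hD).add
      (hE.mul_right _)).add (hL.mul_right _)).add (hE.mul_right _)).add (.refl _)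

/-! ### From the search to exact bounds -/

section System

variable {e r u : ℕ → ℕ}

/-- The exponent equation of the `j`-th prime with its coefficients in closed form. -/
theorem exponent_eq (hlen : ∀ k ∈ Finset.range 30, u k ∈ lengths k)
    (heq : ∀ j ∈ Finset.range 30, e j = ∑ k ∈ Finset.range 30,
      ((2 ^ r k - 1) * (succParts k).count j + 2 ^ r k * (parts k (u k)).count j))
    {j : ℕ} (hj : j < 30) {G : ℕ → ℕ} {F : ℕ → ℕ → ℕ}
    (h : ∀ k < 30, (succParts k).count j = G k ∧ ∀ w ∈ lengths k, (parts k w).count j = F k w) :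
    e j = ∑ k ∈ Finset.range 30, ((2 ^ r k - 1) * G k + 2 ^ r k * F k (u k)) := by
  rw [heq j (Finset.mem_range.mpr hj)]
  refine Finset.sum_congr rfl fun k hk => ?_
  obtain ⟨h1, h2⟩ := h k (Finset.mem_range.mp hk)
  rw [h1, h2 _ (hlen k hk)]

/-- The solutions of the exponent equations: either there is no odd prime, or all exponents are
small. -/
theorem solve_exponents (he : ∀ k ∈ Finset.range 30, Odd (u k) ∧ e k + 1 = 2 ^ r k * u k)
    (hlen : ∀ k ∈ Finset.range 30, u k ∈ lengths k)
    (heq : ∀ j ∈ Finset.range 30, e j = ∑ k ∈ Finset.range 30,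
      ((2 ^ r k - 1) * (succParts k).count j + 2 ^ r k * (parts k (u k)).count j)) :
    (2 ^ r 0 ≤ 16 ∧ 2 ^ r 1 ≤ 16 ∨ ∀ k ∈ Finset.range 30, 2 ≤ k → 2 ^ r k * u k = 1) ∧
    2 ^ r 2 ≤ 16 ∧ 2 ^ r 3 ≤ 8 ∧ 2 ^ r 4 ≤ 8 ∧ 2 ^ r 5 ≤ 16 ∧ 2 ^ r 6 ≤ 16 ∧ 2 ^ r 15 ≤ 8 ∧
    (∀ k ∈ Finset.Icc 7 14, 2 ^ r k = 1 ∧ u k = 1) ∧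
    ∀ k ∈ Finset.Icc 16 29, 2 ^ r k ≤ 2 ∧ u k = 1 := by
  have hunit : ∀ k < 30, lengths k = [1] → u k = 1 := fun k hk h => by
    have := hlen k (Finset.mem_range.mpr hk)
    rw [h] at this
    exact List.mem_singleton.mp this
  have hpow : ∀ k < 30, 2 ^ r k * u k = 1 + e k := fun k hk => by
    rw [← (he k (Finset.mem_range.mpr hk)).2, add_comm]
  -- These are `M 6`, …, `M 13` and `S 9`, …, `S 15`: they divide no `1 + P` and no admissible
  -- geometric sum, so their exponents vanish.
  have hzero : ∀ k ∈ Finset.Icc 7 14 ∪ Finset.Icc 23 29, 2 ^ r k = 1 ∧ u k = 1 := by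
    intro k hk
    have hk' : k < 30 ∧ ∀ i < 30, (succParts i).count k = 0 ∧
        ∀ w ∈ lengths i, (parts i w).count k = 0 := by
      revert k; decide +kernel
    have h0 := exponent_eq hlen heq hk'.1 (G := fun _ => 0) (F := fun _ _ => 0) hk'.2
    have h1 := hpow k hk'.1
    simp only [mul_zero, add_zero, Finset.sum_const_zero] at h0
    rw [h0] at h1
    exact eq_one_of_two_pow_mul_eq_one h1
  have h3 := exponent_eq hlen heq (j := 3) (by norm_num) (G := fun _ => 0)
    (F := fun
      | 0, w => ind w 7 | 1, w => ind w 7 | 2, w => ind w 7 | _, _ => 0) (by decide +kernel)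
  have h4 := exponent_eq hlen heq (j := 4) (by norm_num) (G := fun _ => 0)
    (F := fun
      | 0, w => ind w 7 | 1, w => ind w 7 | 2, w => ind w 7 | _, _ => 0) (by decide +kernel)
  have h5 := exponent_eq hlen heq (j := 5) (by norm_num) (G := fun _ => 0)
    (F := fun
      | 0, w => ind w 5 + ind w 15 | 1, w => ind w 15
      | 2, w => ind w 15 | 4, w => ind w 3 | 15, w => ind w 3 | _, _ => 0)
    (by decide +kernel)
  have h6 := exponent_eq hlen heq (j := 6) (by norm_num) (G := fun _ => 0)
    (F := fun
      | 0, w => ind w 15 | 1, w => ind w 5 + ind w 15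
      | 2, w => ind w 15 | 3, w => ind w 3 | 15, w => ind w 3 | _, _ => 0)
    (by decide +kernel)
  have h15 := exponent_eq hlen heq (j := 15) (by norm_num) (G := fun _ => 0)
    (F := fun
      | 0, w => ind w 15 | 1, w => ind w 15
      | 2, w => ind w 3 + ind w 15 | 16, w => ind w 3 | _, _ => 0)
    (by decide +kernel)
  have h16 := exponent_eq hlen heq (j := 16) (by norm_num) (G := fun _ => 0)
    (F := fun
      | 2, w => ind w 7 | _, _ => 0) (by decide +kernel)
  have h17 := exponent_eq hlen heq (j := 17) (by norm_num) (G := fun _ => 0)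
    (F := fun
      | 0, w => ind w 13 | _, _ => 0) (by decide +kernel)
  have h18 := exponent_eq hlen heq (j := 18) (by norm_num) (G := fun _ => 0)
    (F := fun
      | 0, w => ind w 9 | _, _ => 0) (by decide +kernel)
  have h19 := exponent_eq hlen heq (j := 19) (by norm_num) (G := fun _ => 0)
    (F := fun
      | 1, w => ind w 9 | _, _ => 0) (by decide +kernel)
  have h20 := exponent_eq hlen heq (j := 20) (by norm_num) (G := fun _ => 0)
    (F := fun
      | 1, w => ind w 13 | _, _ => 0) (by decide +kernel)
  have h21 := exponent_eq hlen heq (j := 21) (by norm_num) (G := fun _ => 0)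
    (F := fun
      | 2, w => ind w 15 | 16, w => ind w 3 | _, _ => 0) (by decide +kernel)
  have h22 := exponent_eq hlen heq (j := 22) (by norm_num) (G := fun _ => 0)
    (F := fun
      | 2, w => ind w 5 + ind w 15 | _, _ => 0) (by decide +kernel)
  have h2 := exponent_eq hlen heq (j := 2) (by norm_num) (G := fun k => (succExps k).2.2)
    (F := fun
      | 0, w => ind w 3 + ind w 9 + ind w 15 | 1, w => ind w 3 + ind w 9 + ind w 15
      | 3, w => ind w 3 | 4, w => ind w 3 | _, _ => 0)
    (by decide +kernel)
  have h0 := exponent_eq hlen heq (j := 0) (by norm_num) (G := fun k => (succExps k).1)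
    (F := fun _ _ => 0) (by decide +kernel)
  have h1 := exponent_eq hlen heq (j := 1) (by norm_num) (G := fun k => (succExps k).2.1)
    (F := fun _ _ => 0) (by decide +kernel)
  simp only [Finset.sum_range_succ, Finset.sum_range_zero, succExps, List.getD_cons_zero,
    List.getD_cons_succ, mul_zero, mul_one, zero_add, add_zero]
    at h3 h4 h5 h6 h15 h16 h17 h18 h19 h20 h21 h22 h2 h0 h1
  have hz : ∀ k, (k ∈ Finset.Icc 7 14 ∪ Finset.Icc 23 29) → 2 ^ r k - 1 = 0 := fun k hk => by
    rw [(hzero k hk).1]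
  rw [hz 23 (by decide), hz 24 (by decide), hz 25 (by decide), hz 26 (by decide),
    hz 27 (by decide), hz 28 (by decide), hz 29 (by decide)] at h0 h1 h2
  rw [hz 7 (by decide), hz 8 (by decide), hz 9 (by decide), hz 10 (by decide), hz 11 (by decide),
    hz 12 (by decide), hz 13 (by decide), hz 14 (by decide)] at h0 h1
  have u5 := hunit 5 (by norm_num) rfl
  have u6 := hunit 6 (by norm_num) rfl
  have u17 := hunit 17 (by norm_num) rfl
  have u18 := hunit 18 (by norm_num) rfl
  have u19 := hunit 19 (by norm_num) rfl
  have u20 := hunit 20 (by norm_num) rfl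
  have u21 := hunit 21 (by norm_num) rfl
  have u22 := hunit 22 (by norm_num) rfl
  have p0 := hpow 0 (by norm_num)
  have p1 := hpow 1 (by norm_num)
  have p2 := hpow 2 (by norm_num)
  have p3 := hpow 3 (by norm_num)
  have p4 := hpow 4 (by norm_num)
  have p5 := hpow 5 (by norm_num)
  have p6 := hpow 6 (by norm_num)
  have p15 := hpow 15 (by norm_num)
  have p16 := hpow 16 (by norm_num)
  have p17 := hpow 17 (by norm_num)
  have p18 := hpow 18 (by norm_num)
  have p19 := hpow 19 (by norm_num)
  have p20 := hpow 20 (by norm_num)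
  have p21 := hpow 21 (by norm_num)
  have p22 := hpow 22 (by norm_num)
  -- `M 2` and `M 3` have the same right-hand side, hence the same power of two and odd part.
  obtain ⟨q34, u34⟩ := two_pow_mul_odd_inj (he 4 (by decide)).1 (he 3 (by decide)).1
    (p4.trans (by rw [h4, ← h3, p3]))
  rw [u17, mul_one, h17] at p17
  rw [u18, mul_one, h18] at p18
  rw [u19, mul_one, h19] at p19
  rw [u20, mul_one, h20] at p20
  rw [u21, mul_one, h21] at p21
  rw [u22, mul_one, h22] at p22
  rw [u5, h5, u34, q34] at p5
  rw [u6, h6] at p6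
  rw [h3] at p3
  rw [h15] at p15
  rw [h16] at p16
  have l0 : u 0 ∈ lengths 0 := hlen 0 (by decide)
  have l1 : u 1 ∈ lengths 1 := hlen 1 (by decide)
  have l2 : u 2 ∈ lengths 2 := hlen 2 (by decide)
  have hind : ind (u 2) 5 + ind (u 2) 15 ≤ 1 := by
    have : ∀ w ∈ lengths 2, ind w 5 + ind w 15 ≤ 1 := by decide
    exact this _ l2
  obtain ⟨q17, n17⟩ := two_pow_eq_one_add_two_pow_mul (ind_le_one _ _) p17
  obtain ⟨q18, n18⟩ := two_pow_eq_one_add_two_pow_mul (ind_le_one _ _) p18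
  obtain ⟨q19, n19⟩ := two_pow_eq_one_add_two_pow_mul (ind_le_one _ _) p19
  obtain ⟨q20, n20⟩ := two_pow_eq_one_add_two_pow_mul (ind_le_one _ _) p20
  obtain ⟨q22, n22⟩ := two_pow_eq_one_add_two_pow_mul hind p22
  rw [h2, q17, q18, q19, q20, p21, q22, u34, q34] at p2
  rw [h0, q17, q18, q19, q20, p21, q22, q34] at p0
  rw [h1, q17, q18, q19, q20, p21, q22, q34] at p1
  have hone := Nat.one_le_two_pow (n := r 0)
  have hone1 := Nat.one_le_two_pow (n := r 1)
  have hone2 := Nat.one_le_two_pow (n := r 2)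
  have hone3 := Nat.one_le_two_pow (n := r 3)
  have hone5 := Nat.one_le_two_pow (n := r 5)
  have hone6 := Nat.one_le_two_pow (n := r 6)
  have hone15 := Nat.one_le_two_pow (n := r 15)
  have hone16 := Nat.one_le_two_pow (n := r 16)
  rw [← add_assoc, ← add_assoc] at p3
  rw [← add_assoc, ← add_assoc, ← add_assoc, ← add_assoc] at p5 p6
  rw [← add_assoc, ← add_assoc, ← add_assoc] at p15
  -- The equations are passed on free of subtraction. For `x` and `x + 1` the terms `2 ^ r - 1`
  -- subtract 12 in all, against the 1 in `1 + e`, which gives the 11; for `M 1` they subtract 2,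
  -- which gives the 1.
  obtain ⟨N, M, L, A, D, E, F, G, hN, hM, hL, hA, hD, hE, hF, hG, small⟩ :=
    exists_smallSolution l0 l1 l2 (hlen 3 (by decide)) (hlen 15 (by decide)) (hlen 16 (by decide))
      n18 n17 n19 n20 n22 p16 p3 p15 p5 p6
      (by
        clear * - p2 hone15 hone16
        rw [p2, mul_left_comm _ 2, mul_left_comm _ 3, mul_left_comm _ 3]
        omega)
      (by
        clear * - p0 hone1 hone2 hone3 hone5 hone6 hone15 hone16
        omega)
      (by
        clear * - p1 hone hone2 hone3 hone5 hone6 hone15 hone16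
        omega)
  obtain ⟨sv, sL, sA, sD, sF, sG, sE, sNM⟩ := small
  have eL := hL.eq_of_lt (lt_of_le_of_lt sL (by norm_num))
  have eA := hA.eq_of_lt (lt_of_le_of_lt sA (by norm_num))
  have eD := hD.eq_of_lt (lt_of_le_of_lt sD (by norm_num))
  have eF := hF.eq_of_lt (lt_of_le_of_lt sF (by norm_num))
  have eG := hG.eq_of_lt (lt_of_le_of_lt sG (by norm_num))
  have eE := hE.eq_of_lt (lt_of_le_of_lt sE (by norm_num))
  have i13 : ind (u 16) 3 = 0 := by rw [sv]; rfl
  refine ⟨?_, eL.trans_le sL, eA.trans_le sA, q34.trans_le (eA.trans_le sA), eF.trans_le sF,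
    eG.trans_le sG, eD.trans_le sD, fun k hk => hzero k (Finset.mem_union_left _ hk), ?_⟩
  · rcases sNM with ⟨sN, sM⟩ | ⟨t0, t1, t2, t3, t15, tL, tA, tD, tF, tG, tE⟩
    · have eN := hN.eq_of_lt (lt_of_le_of_lt sN (by norm_num))
      have eM := hM.eq_of_lt (lt_of_le_of_lt sM (by norm_num))
      exact .inl ⟨eN.trans_le sN, eM.trans_le sM⟩
    -- In this alternative `r 0` and `r 1` are not bounded, but every other exponent is zero.
    · right
      intro k hk hk2
      by_cases hk' : k ∈ Finset.Icc 7 14 ∪ Finset.Icc 23 29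
      · rw [(hzero k hk').1, (hzero k hk').2]
      · have hk3 : k ∈ ([2, 3, 4, 5, 6, 15, 16, 17, 18, 19, 20, 21, 22] : List ℕ) := by
          clear * - hk hk2 hk'
          revert k; decide
        simp only [List.mem_cons, List.not_mem_nil, or_false] at hk3
        rcases hk3 with rfl | rfl | rfl | rfl | rfl | rfl | rfl | rfl | rfl | rfl | rfl | rfl | rfl
        · rw [eL, tL, t2]
        · rw [eA, tA, t3]
        · rw [q34, eA, tA, u34, t3]
        · rw [eF, tF, u5]
        · rw [eG, tG, u6]
        · rw [eD, tD, t15]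
        · rw [eE, tE, sv]
        · rw [q17, t0, u17]; rfl
        · rw [q18, t0, u18]; rfl
        · rw [q19, t1, u19]; rfl
        · rw [q20, t1, u20]; rfl
        · rw [p21, u21, i13, t2, eL, tL]; rfl
        · rw [q22, t2, u22]; rfl
  · intro k hk
    by_cases hk' : k ∈ Finset.Icc 7 14 ∪ Finset.Icc 23 29
    · exact ⟨by rw [(hzero k hk').1]; norm_num, (hzero k hk').2⟩
    · have hk3 : k ∈ ([16, 17, 18, 19, 20, 21, 22] : List ℕ) := by
        clear * - hk hk'
        revert k; decide
      have i1 := ind_le_one (u 0) 13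
      have i2 := ind_le_one (u 0) 9
      have i3 := ind_le_one (u 1) 9
      have i4 := ind_le_one (u 1) 13
      -- If `u 2 = 15`, the equation of `S 8` forces `2 ^ r 2 = 1`.
      have i5 : 2 ^ r 2 * ind (u 2) 15 ≤ 1 := by
        rcases Nat.le_one_iff_eq_zero_or_eq_one.mp (ind_le_one (u 2) 15) with h | h
        · rw [h]; norm_num
        · rw [h, mul_one, n22 (by clear * - h hind; omega)]
      rw [i13, mul_zero] at p21
      simp only [List.mem_cons, List.not_mem_nil, or_false] at hk3
      rcases hk3 with rfl | rfl | rfl | rfl | rfl | rfl | rfl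
      · exact ⟨eE.trans_le sE, sv⟩
      · exact ⟨q17.trans_le (Nat.add_le_add_left i1 1), u17⟩
      · exact ⟨q18.trans_le (Nat.add_le_add_left i2 1), u18⟩
      · exact ⟨q19.trans_le (Nat.add_le_add_left i3 1), u19⟩
      · exact ⟨q20.trans_le (Nat.add_le_add_left i4 1), u20⟩
      · exact ⟨p21.trans_le (Nat.add_le_add_left i5 1), u21⟩
      · exact ⟨q22.trans_le (Nat.add_le_add_left hind 1), u22⟩

end System

/-! ### The family written out -/

theorem fam_zero : fam 0 = X := toPoly_two

theorem fam_one : fam 1 = X + 1 := by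
  rw [← toPoly_two, ← toPoly_one, ← toPoly_xor]; rfl

/-- The bridge from masks to the given primes, all of which have this shape. -/
theorem fam_eq_one_add {k : ℕ} (hk : k ∈ Finset.range 30) :
    fam k = 1 + X ^ (succExps k).1 * (X + 1) ^ (succExps k).2.1 * fam 2 ^ (succExps k).2.2 := by
  have h : ∀ k < 30, mask k = 1 ^^^ maskList (succParts k) := by decide +kernel
  rw [fam, h k (Finset.mem_range.mp hk), toPoly_xor, toPoly_maskList, toPoly_one, succParts]
  simp [List.map_replicate, List.prod_replicate, fam_zero, fam_one, mul_assoc]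

theorem M_one_eq : M 1 = fam 2 := by
  rw [fam_eq_one_add (by decide)]
  simp only [M, succExps, List.getD_cons_succ, List.getD_cons_zero]
  ring

theorem M_eq_fam {i : ℕ} (hi : i ∈ Finset.Icc 1 13) : M i = fam (i + 1) := by
  rw [fam_eq_one_add (by simp only [Finset.mem_Icc] at hi; simp; omega)]
  obtain ⟨h, h'⟩ := Finset.mem_Icc.mp hi
  interval_cases i <;>
    simp only [M, bar, succExps, List.getD_cons_succ, List.getD_cons_zero, add_comp, pow_comp,
      X_comp, one_comp] <;> ring_nf <;> reduce_mod_char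

theorem S_eq_fam {j : ℕ} (hj : j ∈ Finset.Icc 1 15) : S j = fam (j + 14) := by
  rw [fam_eq_one_add (by simp only [Finset.mem_Icc] at hj; simp; omega)]
  obtain ⟨h, h'⟩ := Finset.mem_Icc.mp hj
  interval_cases j <;> simp only [S, twoMersenne, M_one_eq] <;> rfl

/-- The values for the `k`-th member of the family, put together from those for `x`, `x + 1`,
the `M i` and the `S j`. -/
def joined (a b : ℕ) (c d : ℕ → ℕ) (k : ℕ) : ℕ :=
  if k = 0 then a else if k = 1 then b else if k < 15 then c (k - 1) else d (k - 14)

theorem oddPart_eq_prod (a b : ℕ) (c d : ℕ → ℕ) :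
    oddPart c d = ∏ k ∈ Finset.range 28, fam (2 + k) ^ joined a b c d (2 + k) := by
  rw [show (28 : ℕ) = 13 + 15 from rfl, Finset.prod_range_add, oddPart]
  refine congrArg₂ (· * ·) ?_ ?_
  · rw [show Finset.Icc 1 13 = Finset.Ico 1 14 from rfl, Finset.prod_Ico_eq_prod_range]
    refine Finset.prod_congr rfl fun k hk => ?_
    have hk' : k < 13 := by simpa using hk
    rw [M_eq_fam (by simp; omega), joined, if_neg (by omega), if_neg (by omega),
      if_pos (by omega)]
    congr 2 <;> omega
  · rw [show Finset.Icc 1 15 = Finset.Ico 1 16 from rfl, Finset.prod_Ico_eq_prod_range]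
    refine Finset.prod_congr rfl fun k hk => ?_
    have hk' : k < 15 := by simpa using hk
    rw [S_eq_fam (by simp; omega), joined, if_neg (by omega), if_neg (by omega),
      if_neg (by omega)]
    congr 2 <;> omega

theorem polyA_eq_prod (a b : ℕ) (c d : ℕ → ℕ) :
    polyA a b c d = ∏ k ∈ Finset.range 30, fam k ^ joined a b c d k := by
  rw [show (30 : ℕ) = 2 + 28 from rfl, Finset.prod_range_add, ← oddPart_eq_prod, polyA,
    Finset.prod_range_succ, Finset.prod_range_one, fam_zero, fam_one]
  rfl

theorem le_of_two_pow_le {n m : ℕ} (h : 2 ^ n ≤ 2 ^ m) : n ≤ m :=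
  (Nat.pow_le_pow_iff_right (by norm_num)).mp h

/-! ### Bounds on all exponents, and finiteness -/

/-- The exponents of a perfect polynomial over the family with a nontrivial odd part. -/
theorem joined_bounds {a b : ℕ} {c d : ℕ → ℕ} {n m u v : ℕ} {ns us ms vs : ℕ → ℕ}
    (hodd : oddPart c d ≠ 1) (ha : Odd u ∧ a + 1 = 2 ^ n * u) (hb : Odd v ∧ b + 1 = 2 ^ m * v)
    (hc : ∀ i ∈ Finset.Icc 1 13, Odd (us i) ∧ c i + 1 = 2 ^ ns i * us i)
    (hd : ∀ j ∈ Finset.Icc 1 15, Odd (vs j) ∧ d j + 1 = 2 ^ ms j * vs j)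
    (h : IsPerfect (polyA a b c d)) :
    (∀ k ∈ Finset.range 30, joined u v us vs k ∈ lengths k) ∧
    (n ≤ 4 ∧ m ≤ 4 ∧ ns 1 ≤ 4) ∧ (ns 2 ≤ 3 ∧ ns 3 ≤ 3 ∧ ms 1 ≤ 3) ∧ (ns 4 ≤ 4 ∧ ns 5 ≤ 4) ∧
    (∀ i ∈ Finset.Icc 6 13, ns i = 0 ∧ us i = 1) ∧
    ∀ j ∈ Finset.Icc 2 15, ms j ≤ 1 ∧ vs j = 1 := by
  have he : ∀ k ∈ Finset.range 30, Odd (joined u v us vs k) ∧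
      joined a b c d k + 1 = 2 ^ joined n m ns ms k * joined u v us vs k := by
    intro k hk
    have hk' := Finset.mem_range.mp hk
    simp only [joined]
    split_ifs with h1 h2 h3
    · exact ha
    · exact hb
    · exact hc _ (by simp; omega)
    · exact hd _ (by simp; omega)
  rw [polyA_eq_prod] at h
  obtain ⟨hlen, heq⟩ := exponents_of_isPerfect he h
  obtain ⟨h01, h2, h3, h4, h5, h6, h15, h7, h16⟩ := solve_exponents he hlen heq
  have h01' : 2 ^ n ≤ 16 ∧ 2 ^ m ≤ 16 := by
    refine h01.resolve_right fun htriv => hodd ?_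
    rw [oddPart_eq_prod a b]
    refine Finset.prod_eq_one fun k hk => ?_
    have hk2 : 2 + k ∈ Finset.range 30 := by
      have := Finset.mem_range.mp hk
      exact Finset.mem_range.mpr (by omega)
    have h1 := (he _ hk2).2
    rw [htriv _ hk2 (by omega)] at h1
    rw [Nat.succ_injective h1, pow_zero]
  refine ⟨hlen, ⟨le_of_two_pow_le h01'.1, le_of_two_pow_le h01'.2, le_of_two_pow_le h2⟩,
    ⟨le_of_two_pow_le h3, le_of_two_pow_le h4, le_of_two_pow_le h15⟩,
    ⟨le_of_two_pow_le h5, le_of_two_pow_le h6⟩, fun i hi => ?_, fun j hj => ?_⟩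
  · obtain ⟨hi1, hi2⟩ := Finset.mem_Icc.mp hi
    have := h7 (i + 1) (by simp; omega)
    simp only [joined, if_neg (show i + 1 ≠ 0 by omega), if_neg (show i + 1 ≠ 1 by omega),
      if_pos (show i + 1 < 15 by omega), Nat.add_sub_cancel] at this
    exact ⟨Nat.le_zero.mp (le_of_two_pow_le this.1.le), this.2⟩
  · obtain ⟨hj1, hj2⟩ := Finset.mem_Icc.mp hj
    have := h16 (j + 14) (by simp; omega)
    simp only [joined, if_neg (show j + 14 ≠ 0 by omega), if_neg (show j + 14 ≠ 1 by omega),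
      if_neg (show ¬ j + 14 < 15 by omega), Nat.add_sub_cancel] at this
    exact ⟨le_of_two_pow_le this.1, this.2⟩

theorem joined_lt {a b : ℕ} {c d : ℕ → ℕ} (hodd : oddPart c d ≠ 1)
    (h : IsPerfect (polyA a b c d)) {k : ℕ} (hk : k ∈ Finset.range 30) :
    joined a b c d k < 256 := by
  obtain ⟨n, u, hu, ha⟩ := Nat.exists_eq_two_pow_mul_odd a.succ_ne_zero
  obtain ⟨m, v, hv, hb⟩ := Nat.exists_eq_two_pow_mul_odd b.succ_ne_zero
  choose ns us hus hc using fun i => Nat.exists_eq_two_pow_mul_odd (c i).succ_ne_zero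
  choose ms vs hvs hd using fun j => Nat.exists_eq_two_pow_mul_odd (d j).succ_ne_zero
  obtain ⟨hlen, ⟨h1, h2, h3⟩, ⟨h4, h5, h6⟩, ⟨h7, h8⟩, h9, h10⟩ :=
    joined_bounds hodd ⟨hu, ha⟩ ⟨hv, hb⟩ (fun i _ => ⟨hus i, hc i⟩) (fun j _ => ⟨hvs j, hd j⟩) h
  have hk' := Finset.mem_range.mp hk
  -- Each exponent is at most `2 ^ 4 * 15 - 1 = 239`; 256 is a convenient larger bound.
  have key : ∀ {x r w : ℕ}, x + 1 = 2 ^ r * w → r ≤ 4 → w ≤ 15 → x < 256 := by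
    intro x r w hx hr hw
    have : 2 ^ r * w ≤ 2 ^ 4 * 15 := Nat.mul_le_mul (Nat.pow_le_pow_right two_pos hr) hw
    omega
  have hw : joined u v us vs k ≤ 15 := by
    have : ∀ k < 30, ∀ w ∈ lengths k, w ≤ 15 := by decide +kernel
    exact this k hk' _ (hlen k hk)
  have hns : ∀ i ∈ Finset.Icc 1 13, ns i ≤ 4 := by
    intro i hi
    by_cases hi6 : i ∈ Finset.Icc 6 13
    · rw [(h9 i hi6).1]; omega
    · simp only [Finset.mem_Icc] at hi hi6
      have : i ≤ 5 := by omega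
      have := hi.1
      interval_cases i <;> omega
  have hms : ∀ j ∈ Finset.Icc 1 15, ms j ≤ 4 := by
    intro j hj
    by_cases hj2 : j ∈ Finset.Icc 2 15
    · exact (h10 j hj2).1.trans (by norm_num)
    · obtain rfl : j = 1 := by simp only [Finset.mem_Icc] at hj hj2; omega
      omega
  revert hw
  simp only [joined]
  split_ifs with k0 k1 k2 <;> intro hw
  · exact key ha h1 hw
  · exact key hb h2 hw
  · exact key (hc _) (hns _ (by simp; omega)) hw
  · exact key (hd _) (hms _ (by simp; omega)) hw

end BinaryPerfect

/-- Each exponent `e` is written `e = 2^k w - 1` with `w` odd, i.e. `e + 1 = 2^k w`. -/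
theorem mainTheorem2 :
    (∀ (a b : ℕ) (c d : ℕ → ℕ) (n m u v : ℕ) (ns us ms vs : ℕ → ℕ),
      1 ≤ a → 1 ≤ b → BinaryPerfect.oddPart c d ≠ 1 →
      (Odd u ∧ a + 1 = 2 ^ n * u) →
      (Odd v ∧ b + 1 = 2 ^ m * v) →
      (∀ i ∈ Finset.Icc 1 13, Odd (us i) ∧ c i + 1 = 2 ^ ns i * us i) →
      (∀ j ∈ Finset.Icc 1 15, Odd (vs j) ∧ d j + 1 = 2 ^ ms j * vs j) →
      BinaryPerfect.IsPerfect (BinaryPerfect.polyA a b c d) →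
        (u ∈ ({1, 3, 5, 7, 9, 13, 15} : Set ℕ) ∧ v ∈ ({1, 3, 5, 7, 9, 13, 15} : Set ℕ)) ∧
        us 1 ∈ ({1, 3, 5, 7, 15} : Set ℕ) ∧
        (us 2 ∈ ({1, 3} : Set ℕ) ∧ us 3 ∈ ({1, 3} : Set ℕ) ∧ vs 1 ∈ ({1, 3} : Set ℕ)) ∧
        (us 4 = 1 ∧ us 5 = 1) ∧
        (∀ i ∈ Finset.Icc 6 13, c i = 0) ∧
        (∀ j ∈ Finset.Icc 2 15, d j ∈ ({0, 1} : Set ℕ) ∧ vs j = 1 ∧ ms j ∈ ({0, 1} : Set ℕ)) ∧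
        (n ≤ 4 ∧ m ≤ 4 ∧ ns 1 ≤ 4) ∧
        (ns 2 ≤ 3 ∧ ns 3 ≤ 3 ∧ ms 1 ≤ 3) ∧
        (ns 4 ≤ 5 ∧ ns 5 ≤ 5)) ∧
    {A : Polynomial (ZMod 2) | BinaryPerfect.IsPerfect A ∧
      ∃ (a b : ℕ) (c d : ℕ → ℕ), 1 ≤ a ∧ 1 ≤ b ∧ BinaryPerfect.oddPart c d ≠ 1 ∧
        A = BinaryPerfect.polyA a b c d}.Finite := by
  refine ⟨?_, ?_⟩
  · intro a b c d n m u v ns us ms vs _ _ hodd hu hv hc hd hA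
    obtain ⟨hlen, h1, h2, ⟨h3, h4⟩, h5, h6⟩ := BinaryPerfect.joined_bounds hodd hu hv hc hd hA
    have hl : ∀ k < 30, BinaryPerfect.joined u v us vs k ∈ BinaryPerfect.lengths k := fun k hk =>
      hlen k (Finset.mem_range.mpr hk)
    have hx := hl 0 (by norm_num)
    have hy := hl 1 (by norm_num)
    have hM1 := hl 2 (by norm_num)
    have hM2 := hl 3 (by norm_num)
    have hM3 := hl 4 (by norm_num)
    have hM4 := hl 5 (by norm_num)
    have hM5 := hl 6 (by norm_num)
    have hS1 := hl 15 (by norm_num)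
    simp only [BinaryPerfect.joined, BinaryPerfect.lengths, List.mem_cons, List.not_mem_nil,
      or_false, if_true, reduceIte,
      OfNat.ofNat_ne_zero, OfNat.ofNat_ne_one, one_ne_zero, Nat.reduceLT, Nat.reduceSub]
      at hx hy hM1 hM2 hM3 hM4 hM5 hS1
    -- For `M 4` and `M 5` the search gives the bound 4, stronger than the 5 required.
    refine ⟨⟨hx, hy⟩, hM1, ⟨hM2, hM3, hS1⟩, ⟨hM4, hM5⟩, fun i hi => ?_, fun j hj => ?_, h1, h2,
      h3.trans (by norm_num), h4.trans (by norm_num)⟩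
    · have hci := (hc i (Finset.Icc_subset_Icc_left (by norm_num) hi)).2
      rw [(h5 i hi).1, (h5 i hi).2] at hci
      simpa using hci
    · have hdj := (hd j (Finset.Icc_subset_Icc_left (by norm_num) hj)).2
      obtain ⟨hm, hv1⟩ := h6 j hj
      rw [hv1, mul_one] at hdj
      rcases Nat.le_one_iff_eq_zero_or_eq_one.mp hm with h | h
      · rw [h] at hdj
        exact ⟨.inl (by simpa using hdj), hv1, .inl h⟩
      · rw [h] at hdj
        exact ⟨.inr (by simpa using hdj), hv1, .inr h⟩
  · refine (Set.finite_range fun f : Fin 30 → Fin 256 =>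
      ∏ k : Fin 30, BinaryPerfect.fam k ^ (f k : ℕ)).subset ?_
    rintro A ⟨hA, a, b, c, d, -, -, hodd, rfl⟩
    refine ⟨fun k => ⟨BinaryPerfect.joined a b c d k,
      BinaryPerfect.joined_lt hodd hA (Finset.mem_range.mpr k.2)⟩, ?_⟩
    rw [BinaryPerfect.polyA_eq_prod]
    exact Fin.prod_univ_eq_prod_range
      (fun k => BinaryPerfect.fam k ^ BinaryPerfect.joined a b c d k) 30
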